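/- Let $n\ge 1$ and let $a=(a_1,\dots,a_n)$ be a uniformly random permutation of $n$ distinct elements of a totally ordered set. In the $i$-th pass of bubble sort ($i=1,2,\dots$), for $j=1,2,\dots,n-i$ in this order, the entries in the positions $j$ and $j+1$ of the current sequence are swapped if the former is larger than the latter. Let $P_n$ be the number of passes required, that is, the least $i+1$ (with $i\ge 0$) such that the sequence is sorted at the end of the $i$-th pass (for $i=0$: the input is sorted), and let $$X_n=\frac{n-P_n}{\sqrt n}.$$ Then, for every fixed integer $k\ge 0$, as $n\to\infty$, $$\mathbb E\left(X_n^k\right)=\sqrt2^{\,k}\left(\Gamma\left(\frac k2+1\right)-\frac{\sqrt2\,k(k+4)}{6\sqrt n}\,\Gamma\left(\frac{k+1}2\right)+r_k(n)\right),\qquad r_k(n)=O\left(\frac1n\right).$$ Moreover, for every fixed $k\ge1$ the order of the remainder is exact: $r_k(n)=\Theta(1/n)$, that is, there are constants $0<c\le C$ depending only on $k$ with $c/n\le|r_k(n)|\le C/n$ for all sufficiently large $n$. -/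

import Mathlib

open MeasureTheory ProbabilityTheory Filter Asymptotics

namespace BubbleSort

/-- One step of bubble sort, with positions counted from `0`: the entries in the positions `j` and
`j + 1` are swapped if they are out of order. (Nothing happens if there is no position `j + 1`.) -/
def step {α : Type*} [LinearOrder α] {n : ℕ} (a : Fin n → α) (j : ℕ) : Fin n → α :=
  if h : j + 1 < n then
    let p : Fin n := ⟨j, Nat.lt_of_succ_lt h⟩
    let q : Fin n := ⟨j + 1, h⟩
    if a q < a p then a ∘ Equiv.swap p q else a
  else a

/-- The `i`-th pass (`i = 1, 2, …`): steps at the first, second, …, `(n - i)`-th position, in this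
order. -/
def pass {α : Type*} [LinearOrder α] {n : ℕ} (i : ℕ) (a : Fin n → α) : Fin n → α :=
  (List.range (n - i)).foldl step a

/-- The sequence at the end of the `i`-th pass; for `i = 0` it is the input. -/
def afterPass {α : Type*} [LinearOrder α] {n : ℕ} (a : Fin n → α) : ℕ → Fin n → α
  | 0 => a
  | i + 1 => pass (i + 1) (afterPass a i)

/-- The number of passes required to bubble sort `a`, the pass that only confirms that `a` is
sorted included: the least `i + 1` such that the sequence is sorted at the end of the `i`-th
pass. -/
noncomputable def numPasses {α : Type*} [LinearOrder α] {n : ℕ} (a : Fin n → α) : ℕ :=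
  sInf {p : ℕ | ∃ i : ℕ, p = i + 1 ∧ Monotone (afterPass a i)}

/-- Every set of permutations of `Fin n` is an event. -/
instance instMeasurableSpacePerm (n : ℕ) : MeasurableSpace (Equiv.Perm (Fin n)) := ⊤

/-- The law of a uniformly random permutation of `n` positions. -/
noncomputable def uniformPerm (n : ℕ) : Measure (Equiv.Perm (Fin n)) :=
  (PMF.uniformOfFintype (Equiv.Perm (Fin n))).toMeasure

/-- The random variable `(n - P) / √n` on the permutations `σ` of `n` positions, where `P` is the
number of passes required to bubble sort the numbers `s 0, …, s (n - 1)` rearranged by `σ`. -/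
noncomputable def normalizedPasses {α : Type*} [LinearOrder α] {n : ℕ} (s : Fin n → α)
    (σ : Equiv.Perm (Fin n)) : ℝ :=
  ((n : ℝ) - (numPasses (s ∘ σ) : ℝ)) / √(n : ℝ)

end BubbleSort

/-! For each position, count the larger entries to its left. A pass carries the running maximum to
the right, so it shifts this table one place to the left and lowers every entry by one, truncated at
zero (`inversionsAt_afterPass`). Hence at most `p` passes are required exactly when every count is
below `p`. The table is a Lehmer code, a bijection onto the product of the sets `{0, …, j}`, so `p!
p ^ (n - p)` permutations qualify (`card_numPasses_le`). This gives the exact tail probability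
`survival n q`, and summation by parts turns the moment into a finite sum over `q`.

Put `h = 1 / √n` and `x = q * h`. Multiplying the successive ratios of `survival` shows that it
equals `exp (-x² / 2)` times `1 - h A(x) + h² (A(x)² / 2 - B(x)) + h³ R`, with `A`, `B` the two
corrections and `R` of polynomial growth in `x`, uniformly in `n` (`polyBounded_survivalRem`). The
moment is thus a Riemann sum of mesh `h` of polynomials times a Gaussian, and Euler–Maclaurin of
order three evaluates it up to `O(h³)` (`tsum_expansion`).

The coefficients of `1` and `h` are the stated Gamma values. With `j = k - 1`, that of `h²` is a
positive multiple of `4j³ + 42j² + 101j + 33`, hence nonzero, which makes the order `1 / n` exact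
(`gaussIntegral_momentPoly₂`). -/

namespace BubbleSort

open Finset

/-! ### Inversion tables, bubble sort passes and the Lehmer code -/

section Inversions

variable {α : Type*} [LinearOrder α] {n : ℕ}

/-- The number of entries to the left of position `i` that are larger than the entry there
(zero if there is no position `i`). -/
def inversionsAt (a : Fin n → α) (i : ℕ) : ℕ :=
  if h : i < n then #{l : Fin n | (l : ℕ) < i ∧ a ⟨i, h⟩ < a l} else 0

theorem inversionsAt_of_le (a : Fin n → α) {i : ℕ} (h : n ≤ i) : inversionsAt a i = 0 := by
  simp [inversionsAt, not_lt.mpr h]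

theorem inversionsAt_of_lt (a : Fin n → α) {i : ℕ} (h : i < n) :
    inversionsAt a i = #{l : Fin n | (l : ℕ) < i ∧ a ⟨i, h⟩ < a l} := by
  simp [inversionsAt, h]

theorem inversionsAt_eq_zero_iff (a : Fin n → α) {i : ℕ} (h : i < n) :
    inversionsAt a i = 0 ↔ ∀ l : Fin n, (l : ℕ) < i → a l ≤ a ⟨i, h⟩ := by
  rw [inversionsAt_of_lt a h, card_eq_zero, filter_eq_empty_iff]
  simp

theorem inversionsAt_le (a : Fin n → α) (i : ℕ) : inversionsAt a i ≤ i := by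
  by_cases h : i < n
  · rw [inversionsAt_of_lt a h]
    calc _ ≤ #(Finset.Iio (⟨i, h⟩ : Fin n)) := by
            apply card_le_card
            intro l hl
            simp only [mem_filter, mem_univ, true_and] at hl
            simpa [Fin.lt_def] using hl.1
      _ = i := by simp
  · rw [inversionsAt_of_le a (not_lt.mp h)]
    exact Nat.zero_le i

theorem inversionsAt_comp_swap (a : Fin n → α) {j i : ℕ} (hj : j + 1 < n) (h1 : i ≠ j)
    (h2 : i ≠ j + 1) :
    inversionsAt (a ∘ Equiv.swap ⟨j, Nat.lt_of_succ_lt hj⟩ ⟨j + 1, hj⟩) i = inversionsAt a i := by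
  by_cases h : i < n
  · rw [inversionsAt_of_lt _ h, inversionsAt_of_lt _ h]
    apply card_equiv (Equiv.swap ⟨j, Nat.lt_of_succ_lt hj⟩ ⟨j + 1, hj⟩)
    intro l
    have hi : (Equiv.swap (⟨j, Nat.lt_of_succ_lt hj⟩ : Fin n) ⟨j + 1, hj⟩) ⟨i, h⟩ = ⟨i, h⟩ :=
      Equiv.swap_apply_of_ne_of_ne (by simpa using h1) (by simpa using h2)
    have hl : ((l : ℕ) < i ↔
        ((Equiv.swap (⟨j, Nat.lt_of_succ_lt hj⟩ : Fin n) ⟨j + 1, hj⟩ l : Fin n) : ℕ) < i) := by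
      rw [Equiv.swap_apply_def]
      split_ifs with e1 e2
      · subst e1; simp only; omega
      · subst e2; simp only; omega
      · rfl
    simp only [mem_filter, mem_univ, true_and, Function.comp_apply, hi]
    rw [hl]
  · rw [inversionsAt_of_le _ (not_lt.mp h), inversionsAt_of_le _ (not_lt.mp h)]

/-- By `h0` the entry at `j` is the maximum of the prefix. If it is swapped, its smaller neighbour
moves left and loses precisely this one inversion. If not, the neighbour is a prefix maximum itself,
and the truncated subtraction gives `0`. -/
theorem inversionsAt_step (a : Fin n → α) {j : ℕ} (hj : j + 1 < n) (h0 : inversionsAt a j = 0)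
    (i : ℕ) :
    inversionsAt (step a j) i =
      if i = j then inversionsAt a (j + 1) - 1 else if i = j + 1 then 0 else inversionsAt a i := by
  have hj' : j < n := Nat.lt_of_succ_lt hj
  rw [inversionsAt_eq_zero_iff a hj'] at h0
  unfold step
  rw [dif_pos hj]
  dsimp only
  split_ifs with hs h1 h2 h1 h2
  · subst h1
    rw [inversionsAt_of_lt _ hj', inversionsAt_of_lt _ hj]
    have : ({l : Fin n | (l : ℕ) < i + 1 ∧ a ⟨i + 1, hj⟩ < a l} : Finset (Fin n)) =
        insert ⟨i, hj'⟩ ({l : Fin n | (l : ℕ) < i ∧ a ⟨i + 1, hj⟩ < a l} : Finset (Fin n)) := by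
      ext l
      simp only [mem_filter, mem_univ, true_and, mem_insert]
      constructor
      · rintro ⟨hl, hl'⟩
        rcases Nat.lt_succ_iff_lt_or_eq.mp hl with h | h
        · exact Or.inr ⟨h, hl'⟩
        · exact Or.inl (Fin.ext h)
      · rintro (rfl | ⟨hl, hl'⟩)
        · exact ⟨Nat.lt_succ_self _, hs⟩
        · exact ⟨Nat.lt_succ_of_lt hl, hl'⟩
    rw [this, card_insert_of_notMem (by simp), Nat.add_sub_cancel]
    congr 1
    ext l
    simp only [mem_filter, mem_univ, true_and, Function.comp_apply, Equiv.swap_apply_left]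
    refine and_congr_right fun hl => ?_
    rw [Equiv.swap_apply_of_ne_of_ne] <;> · rw [Ne, Fin.ext_iff]; simp only; omega
  · subst h2
    rw [inversionsAt_eq_zero_iff _ hj]
    intro l hl
    simp only [Function.comp_apply, Equiv.swap_apply_right]
    rw [Equiv.swap_apply_def]
    split_ifs with e1 e2
    · exact hs.le
    · exact le_rfl
    · refine h0 l ?_
      rw [Fin.ext_iff] at e1
      simp only at e1
      omega
  · exact inversionsAt_comp_swap a hj h1 h2
  · subst h1
    have e : inversionsAt a (i + 1) = 0 := by
      rw [inversionsAt_eq_zero_iff _ hj]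
      intro l hl
      rcases Nat.lt_succ_iff_lt_or_eq.mp hl with h | h
      · exact (h0 l h).trans (not_lt.mp hs)
      · have : l = ⟨i, hj'⟩ := Fin.ext h
        rw [this]; exact not_lt.mp hs
    rw [e, (inversionsAt_eq_zero_iff a hj').mpr h0]
  · subst h2
    rw [inversionsAt_eq_zero_iff _ hj]
    intro l hl
    rcases Nat.lt_succ_iff_lt_or_eq.mp hl with h | h
    · exact (h0 l h).trans (not_lt.mp hs)
    · have : l = ⟨j, hj'⟩ := Fin.ext h
      rw [this]; exact not_lt.mp hs
  · rfl

theorem inversionsAt_foldl_step (a : Fin n → α) {m : ℕ} (hm : m < n) (i : ℕ) :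
    inversionsAt ((List.range m).foldl step a) i =
      if i < m then inversionsAt a (i + 1) - 1 else if i = m then 0 else inversionsAt a i := by
  induction m generalizing i with
  | zero =>
    split_ifs with h1 h2
    · omega
    · subst h2
      simpa using inversionsAt_le a 0
    · simp
  | succ m ih =>
    have ih := ih (by omega)
    rw [List.range_succ, List.foldl_append, List.foldl_cons, List.foldl_nil,
      inversionsAt_step _ hm (by simp [ih])]
    simp only [ih]
    split_ifs <;> first | rfl | omega | (subst_vars; rfl)

/-- Shortening the later passes does no harm: the positions they leave out already have no
inversions, and there `j + i` lies beyond the table, where the count is `0` by convention. -/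
theorem inversionsAt_afterPass (a : Fin n → α) {i : ℕ} (hi : i ≤ n) (j : ℕ) :
    inversionsAt (afterPass a i) j = inversionsAt a (j + i) - i := by
  induction i generalizing j with
  | zero => simp [afterPass]
  | succ i ih =>
    have ih := ih (by omega)
    rw [afterPass, pass, inversionsAt_foldl_step _ (by omega)]
    simp only [ih]
    split_ifs with h1 h2
    · rw [show j + 1 + i = j + (i + 1) by omega]; omega
    · rw [inversionsAt_of_le a (by omega)]
      omega
    · rw [inversionsAt_of_le a (by omega), inversionsAt_of_le a (by omega)]
      omega

theorem monotone_iff_inversionsAt (a : Fin n → α) : Monotone a ↔ ∀ i, inversionsAt a i = 0 := by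
  constructor
  · intro h i
    by_cases hi : i < n
    · exact (inversionsAt_eq_zero_iff a hi).mpr fun l hl => h (Fin.le_def.mpr hl.le)
    · exact inversionsAt_of_le a (not_lt.mp hi)
  · intro h l m hlm
    rcases hlm.eq_or_lt with rfl | hlt
    · exact le_rfl
    · exact (inversionsAt_eq_zero_iff a m.2).mp (h m) l hlt

/-- The shifted table only sees positions from `i` on; earlier ones satisfy the bound anyway, since
a count never exceeds its position. -/
theorem monotone_afterPass_iff (a : Fin n → α) {i : ℕ} (hi : i ≤ n) :
    Monotone (afterPass a i) ↔ ∀ j, inversionsAt a j ≤ i := by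
  rw [monotone_iff_inversionsAt]
  simp only [inversionsAt_afterPass a hi]
  constructor
  · intro h j
    by_cases hj : i ≤ j
    · have := h (j - i)
      rw [Nat.sub_add_cancel hj] at this
      omega
    · exact (inversionsAt_le a j).trans (by omega)
  · intro h j
    have := h (j + i)
    omega

theorem inversionsAt_lt (a : Fin n → α) (hn : 1 ≤ n) (j : ℕ) : inversionsAt a j ≤ n - 1 := by
  by_cases hj : j < n
  · exact (inversionsAt_le a j).trans (by omega)
  · rw [inversionsAt_of_le a (not_lt.mp hj)]; omega

theorem numPasses_le_iff (a : Fin n → α) {p : ℕ} (hp : 1 ≤ p) (hpn : p ≤ n) :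
    numPasses a ≤ p ↔ ∀ j, inversionsAt a j < p := by
  -- Pass `n - 1` always suffices, so the infimum is attained and is not the default value `0`.
  have hne : {p : ℕ | ∃ i : ℕ, p = i + 1 ∧ Monotone (afterPass a i)}.Nonempty :=
    ⟨n - 1 + 1, n - 1, rfl, (monotone_afterPass_iff a (by omega)).mpr
      (inversionsAt_lt a (by omega))⟩
  constructor
  · intro h j
    obtain ⟨i, hi, hmon⟩ := Nat.sInf_mem hne
    rw [show sInf _ = numPasses a from rfl] at hi
    have := (monotone_afterPass_iff a (by omega)).mp hmon j
    omega
  · intro h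
    refine Nat.sInf_le ⟨p - 1, by omega, (monotone_afterPass_iff a (by omega)).mpr fun j => ?_⟩
    have := h j
    omega

theorem one_le_numPasses (a : Fin n → α) (hn : 1 ≤ n) : 1 ≤ numPasses a := by
  have hne : {p : ℕ | ∃ i : ℕ, p = i + 1 ∧ Monotone (afterPass a i)}.Nonempty :=
    ⟨n - 1 + 1, n - 1, rfl, (monotone_afterPass_iff a (by omega)).mpr
      (inversionsAt_lt a (by omega))⟩
  obtain ⟨i, hi, -⟩ := Nat.sInf_mem hne
  rw [show sInf _ = numPasses a from rfl] at hi
  omega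

theorem numPasses_le (a : Fin n → α) (hn : 1 ≤ n) : numPasses a ≤ n :=
  (numPasses_le_iff a hn le_rfl).mpr fun j => by
    have := inversionsAt_lt a hn j
    omega

/-- The Lehmer code of the rearrangement of `s` by `σ`. -/
def lehmerCode (s : Fin n → α) (σ : Equiv.Perm (Fin n)) : ∀ j : Fin n, Fin ((j : ℕ) + 1) :=
  fun j => ⟨inversionsAt (s ∘ σ) j, Nat.lt_succ_of_le (inversionsAt_le _ _)⟩

/-- The permutation is decoded from the right. Once the entries beyond `j` are known, so is the set
of values in the positions up to `j`, and the code at `j` is the rank, counted from above, of the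
entry at `j` in this set. -/
theorem lehmerCode_injective {s : Fin n → α} (hs : Function.Injective s) :
    Function.Injective (lehmerCode s) := by
  intro σ τ hστ
  have key : ∀ m : ℕ, ∀ j : Fin n, n - 1 - (j : ℕ) = m → σ j = τ j := by
    intro m
    induction m using Nat.strong_induction_on with
    | _ m ih =>
      intro j hjm
      have hgt : ∀ l, j < l → σ l = τ l := fun l hl => by
        have := l.2
        exact ih (n - 1 - l) (by rw [Fin.lt_def] at hl; omega) l rfl
      have hmem : ∀ (ρ : Equiv.Perm (Fin n)) (v : Fin n), (∃ l ≤ j, ρ l = v) ↔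
          ∀ l, j < l → ρ l ≠ v := by
        intro ρ v
        constructor
        · rintro ⟨l, hl, rfl⟩ l' hl' h
          exact (hl.trans_lt hl').ne' (ρ.injective h)
        · intro h
          refine ⟨ρ.symm v, ?_, by simp⟩
          by_contra hlt
          exact h _ (not_le.mp hlt) (by simp)
      have hV : ∀ v, (∃ l ≤ j, σ l = v) ↔ ∃ l ≤ j, τ l = v := by
        intro v
        rw [hmem, hmem]
        exact forall₂_congr fun l hl => by rw [hgt l hl]
      have hcard : ∀ ρ : Equiv.Perm (Fin n), inversionsAt (s ∘ ρ) j =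
          #{v : Fin n | (∃ l ≤ j, ρ l = v) ∧ s (ρ j) < s v} := by
        intro ρ
        rw [inversionsAt_of_lt _ j.2]
        apply card_equiv ρ
        intro l
        simp only [mem_filter, mem_univ, true_and, Function.comp_apply, Fin.eta]
        constructor
        · rintro ⟨h1, h2⟩
          exact ⟨⟨l, Fin.le_def.mpr h1.le, rfl⟩, h2⟩
        · rintro ⟨⟨l', h1, h2⟩, h3⟩
          obtain rfl := ρ.injective h2
          refine ⟨lt_of_le_of_ne h1 ?_, h3⟩
          intro h
          obtain rfl := Fin.ext h
          exact lt_irrefl _ h3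
      have hc : #{v : Fin n | (∃ l ≤ j, σ l = v) ∧ s (σ j) < s v} =
          #{v : Fin n | (∃ l ≤ j, σ l = v) ∧ s (τ j) < s v} := by
        have h1 := congrArg Fin.val (congrFun hστ j)
        change inversionsAt (s ∘ σ) j = inversionsAt (s ∘ τ) j at h1
        rw [hcard, hcard] at h1
        simpa only [hV] using h1
      have hlt : ∀ u w : Fin n, (∃ l ≤ j, σ l = w) → s u < s w →
          #{v : Fin n | (∃ l ≤ j, σ l = v) ∧ s w < s v} <
          #{v : Fin n | (∃ l ≤ j, σ l = v) ∧ s u < s v} := by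
        intro u w hw huw
        apply card_lt_card
        rw [Finset.ssubset_iff_of_subset]
        · exact ⟨w, by simp only [mem_filter, mem_univ, true_and]; exact ⟨hw, huw⟩, by simp⟩
        · intro v hv
          simp only [mem_filter, mem_univ, true_and] at hv ⊢
          exact ⟨hv.1, huw.trans hv.2⟩
      rcases lt_trichotomy (s (σ j)) (s (τ j)) with h | h | h
      · exact absurd hc (hlt _ _ ((hV _).mpr ⟨j, le_rfl, rfl⟩) h).ne'
      · exact hs h
      · exact absurd hc (hlt _ _ ⟨j, le_rfl, rfl⟩ h).ne
  exact Equiv.ext fun j => key _ j rfl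

theorem lehmerCode_bijective {s : Fin n → α} (hs : Function.Injective s) :
    Function.Bijective (lehmerCode s) := by
  rw [Fintype.bijective_iff_injective_and_card]
  refine ⟨lehmerCode_injective hs, ?_⟩
  rw [Fintype.card_perm, Fintype.card_fin, Fintype.card_pi]
  simp only [Fintype.card_fin]
  rw [Fin.prod_univ_eq_prod_range (fun j => j + 1) n, Finset.prod_range_add_one_eq_factorial]

theorem prod_range_min (n p : ℕ) (hp : p ≤ n) :
    ∏ j ∈ range n, min (j + 1) p = p.factorial * p ^ (n - p) := by
  obtain ⟨m, rfl⟩ := Nat.exists_eq_add_of_le hp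
  rw [prod_range_add, Nat.add_sub_cancel_left, ← prod_range_add_one_eq_factorial]
  congr 1
  · exact prod_congr rfl fun j hj => min_eq_left (mem_range.mp hj)
  · rw [prod_congr rfl fun j _ => min_eq_right (by omega : p ≤ p + j + 1)]
    simp

/-- In terms of the code the condition splits into independent ones, and the digit at `j` has `min
(j + 1) p` admissible values. -/
theorem card_numPasses_le {s : Fin n → α} (hs : Function.Injective s) {p : ℕ} (hp : 1 ≤ p)
    (hpn : p ≤ n) :
    #{σ : Equiv.Perm (Fin n) | numPasses (s ∘ σ) ≤ p} = p.factorial * p ^ (n - p) := by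
  have h1 : #{σ : Equiv.Perm (Fin n) | numPasses (s ∘ σ) ≤ p} =
      #(Fintype.piFinset fun j : Fin n => ({c | (c : ℕ) < p} : Finset (Fin ((j : ℕ) + 1)))) := by
    apply card_bijective (lehmerCode s) (lehmerCode_bijective hs)
    intro σ
    simp only [mem_filter, mem_univ, true_and, Fintype.mem_piFinset, numPasses_le_iff _ hp hpn]
    constructor
    · exact fun h j => h j
    · intro h j
      by_cases hj : j < n
      · exact h ⟨j, hj⟩
      · rw [inversionsAt_of_le _ (not_lt.mp hj)]; omega
  rw [h1, Fintype.card_piFinset, ← prod_range_min n p hpn, ← Fin.prod_univ_eq_prod_range]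
  refine prod_congr rfl fun j _ => ?_
  simp [Fin.card_filter_val_lt]

end Inversions

/-! ### Tail probabilities and exact moments -/

/-- The probability that at most `n - q` passes are required. -/
noncomputable def survival (n q : ℕ) : ℝ :=
  ((n - q).factorial : ℝ) * ((n - q : ℕ) : ℝ) ^ q / (n.factorial : ℝ)

theorem survival_of_le {n q : ℕ} (hn : 1 ≤ n) (h : n ≤ q) : survival n q = 0 := by
  -- A nonzero exponent excludes `0 ^ 0 = 1`.
  have : q ≠ 0 := by omega
  simp [survival, Nat.sub_eq_zero_of_le h, this]

theorem card_le_sub_numPasses {α : Type*} [LinearOrder α] {n : ℕ} {s : Fin n → α}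
    (hs : Function.Injective s) (hn : 1 ≤ n) (q : ℕ) :
    (#{σ : Equiv.Perm (Fin n) | q ≤ n - numPasses (s ∘ σ)} : ℝ) =
      n.factorial * survival n q := by
  by_cases hq : n ≤ q
  · rw [survival_of_le hn hq, mul_zero, Nat.cast_eq_zero, card_eq_zero, filter_eq_empty_iff]
    intro σ _ h
    have := one_le_numPasses (s ∘ σ) hn
    omega
  · have h1 : ∀ σ : Equiv.Perm (Fin n), q ≤ n - numPasses (s ∘ σ) ↔
        numPasses (s ∘ σ) ≤ n - q := by
      intro σ
      have := numPasses_le (s ∘ σ) hn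
      omega
    simp only [h1]
    rw [card_numPasses_le hs (by omega) (by omega), show n - (n - q) = q by omega, survival,
      mul_div_cancel₀ _ (by positivity)]
    push_cast
    ring

/-- Summation by parts: `m ^ k` telescopes over `q < m`, with `0 ^ k = 0` because `k ≠ 0`;
exchanging the sums then leaves tail probabilities. -/
theorem moment_normalizedPasses {α : Type*} [LinearOrder α] {n : ℕ} {s : Fin n → α}
    (hs : Function.Injective s) (hn : 1 ≤ n) {k : ℕ} (hk : k ≠ 0) :
    moment (normalizedPasses s) k (uniformPerm n) =
      ∑ q ∈ range n, (((q : ℝ) + 1) ^ k - (q : ℝ) ^ k) * survival n (q + 1) / √(n : ℝ) ^ k := by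
  have hint : moment (normalizedPasses s) k (uniformPerm n) =
      ∑ σ : Equiv.Perm (Fin n), (n.factorial : ℝ)⁻¹ * normalizedPasses s σ ^ k := by
    rw [moment, uniformPerm, PMF.integral_eq_sum]
    refine sum_congr rfl fun σ _ => ?_
    simp [PMF.uniformOfFintype_apply, Fintype.card_perm]
  have hpow : ∀ σ : Equiv.Perm (Fin n), normalizedPasses s σ ^ k =
      ∑ q ∈ range n, if q + 1 ≤ n - numPasses (s ∘ σ) then
        (((q : ℝ) + 1) ^ k - (q : ℝ) ^ k) / √(n : ℝ) ^ k else 0 := by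
    intro σ
    have h1 := numPasses_le (s ∘ σ) hn
    have h2 : (range n).filter (fun q => q + 1 ≤ n - numPasses (s ∘ σ)) =
        range (n - numPasses (s ∘ σ)) := by
      ext q
      simp only [mem_filter, mem_range]
      omega
    rw [← sum_filter, h2, ← sum_div, normalizedPasses, div_pow, ← Nat.cast_sub h1]
    have h3 := sum_range_sub (fun q : ℕ => (q : ℝ) ^ k) (n - numPasses (s ∘ σ))
    push_cast at h3
    rw [h3]
    simp [hk]
  rw [hint]
  simp only [hpow, mul_sum]
  rw [sum_comm]
  refine sum_congr rfl fun q _ => ?_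
  rw [← mul_sum, ← sum_filter, sum_const, nsmul_eq_mul, card_le_sub_numPasses hs hn]
  have : (n.factorial : ℝ) ≠ 0 := by positivity
  field_simp

end BubbleSort

namespace BubbleSort

/-! ### Euler–Maclaurin summation with three derivatives -/

section EulerMaclaurin

open Set intervalIntegral

/-- One step of the Euler–Maclaurin formula of order three. -/
theorem abs_integral_sub_trapezoid_le {F F₁ F₂ F₃ : ℝ → ℝ} (h1 : ∀ x, HasDerivAt F (F₁ x) x)
    (h2 : ∀ x, HasDerivAt F₁ (F₂ x) x) (h3 : ∀ x, HasDerivAt F₂ (F₃ x) x) (hc : Continuous F₃)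
    (a : ℝ) {h : ℝ} (hh : 0 ≤ h) :
    |(∫ x in a..a + h, F x) - h * (F a + F (a + h)) / 2 + h ^ 2 * (F₁ (a + h) - F₁ a) / 12| ≤
      h ^ 3 * ∫ x in a..a + h, |F₃ x| := by
  -- With `u = x - a`, this is `-u (2u - h) (u - h) / 12`. It vanishes at both ends, where `K₁`
  -- equals `-h² / 12` and `K₂` equals `±h / 2`, so integrating `K * F₃` by parts yields exactly the
  -- trapezoid and derivative corrections.
  set K : ℝ → ℝ := fun x => -((x - a) ^ 3 / 6 - h * (x - a) ^ 2 / 4 + h ^ 2 * (x - a) / 12)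
  set K₁ : ℝ → ℝ := fun x => -((x - a) ^ 2 / 2 - h * (x - a) / 2 + h ^ 2 / 12)
  set K₂ : ℝ → ℝ := fun x => -((x - a) - h / 2)
  have hK : ∀ x, HasDerivAt K (K₁ x) x := by
    intro x
    have e := (hasDerivAt_id x).sub_const a
    refine ((((e.pow 3).div_const 6).sub (((e.pow 2).const_mul h).div_const 4)).add
      ((e.const_mul (h ^ 2)).div_const 12)).neg.congr_deriv ?_
    simp [K₁]; ring
  have hK₁ : ∀ x, HasDerivAt K₁ (K₂ x) x := by
    intro x
    have e := (hasDerivAt_id x).sub_const a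
    refine ((((e.pow 2).div_const 2).sub ((e.const_mul h).div_const 2)).add_const
      (h ^ 2 / 12)).neg.congr_deriv ?_
    simp [K₂]
  have hK₂ : ∀ x, HasDerivAt K₂ (-1) x := by
    intro x
    exact (((hasDerivAt_id x).sub_const a).sub_const (h / 2)).neg
  have hF : Continuous F := continuous_iff_continuousAt.mpr fun x => (h1 x).continuousAt
  have hKc : Continuous K := continuous_iff_continuousAt.mpr fun x => (hK x).continuousAt
  have hH : ∀ x, HasDerivAt (fun x => K x * F₂ x - K₁ x * F₁ x + K₂ x * F x)
      (K x * F₃ x - F x) x := by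
    intro x
    refine ((((hK x).mul (h3 x)).sub ((hK₁ x).mul (h2 x))).add
      ((hK₂ x).mul (h1 x))).congr_deriv ?_
    ring
  have key := integral_eq_sub_of_hasDerivAt (a := a) (b := a + h) (fun x _ => hH x)
    ((hKc.mul hc).sub hF).continuousOn.intervalIntegrable
  rw [integral_sub (f := fun x => K x * F₃ x) ((hKc.mul hc).intervalIntegrable _ _)
    (hF.intervalIntegrable _ _)] at key
  have e : (∫ x in a..a + h, F x) - h * (F a + F (a + h)) / 2 +
      h ^ 2 * (F₁ (a + h) - F₁ a) / 12 = ∫ x in a..a + h, K x * F₃ x := by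
    rw [sub_eq_iff_eq_add] at key
    rw [key]
    simp only [K, K₁, K₂]
    ring
  rw [e, ← intervalIntegral.integral_const_mul]
  refine (abs_integral_le_integral_abs (by linarith)).trans ?_
  refine integral_mono_on (by linarith) ((hKc.mul hc).abs.intervalIntegrable _ _)
    ((hc.abs.const_mul _).intervalIntegrable _ _) ?_
  intro x hx
  rw [abs_mul]
  refine mul_le_mul_of_nonneg_right ?_ (abs_nonneg _)
  have u0 : 0 ≤ x - a := by linarith [hx.1]
  have u1 : x - a ≤ h := by linarith [hx.2]
  simp only [K, abs_neg]
  generalize x - a = u at u0 u1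
  have a3 : u ^ 3 ≤ h ^ 3 := pow_le_pow_left₀ u0 u1 3
  have a2 : h * u ^ 2 ≤ h * h ^ 2 := mul_le_mul_of_nonneg_left (pow_le_pow_left₀ u0 u1 2) hh
  have a1 : h ^ 2 * u ≤ h ^ 2 * h := mul_le_mul_of_nonneg_left u1 (sq_nonneg h)
  have b3 : 0 ≤ u ^ 3 := by positivity
  have b2 : 0 ≤ h * u ^ 2 := by positivity
  have b1 : 0 ≤ h ^ 2 * u := by positivity
  rw [abs_le]
  constructor <;> nlinarith

theorem abs_integral_sub_sum_le {F F₁ F₂ F₃ : ℝ → ℝ} (h1 : ∀ x, HasDerivAt F (F₁ x) x)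
    (h2 : ∀ x, HasDerivAt F₁ (F₂ x) x) (h3 : ∀ x, HasDerivAt F₂ (F₃ x) x) (hc : Continuous F₃)
    {h : ℝ} (hh : 0 ≤ h) (N : ℕ) :
    |(∫ x in (0 : ℝ)..N * h, F x) - ∑ q ∈ Finset.range N, h * F ((q + 1) * h) +
        h * (F (N * h) - F 0) / 2 + h ^ 2 * (F₁ (N * h) - F₁ 0) / 12| ≤
      h ^ 3 * ∫ x in (0 : ℝ)..N * h, |F₃ x| := by
  have hF : Continuous F := continuous_iff_continuousAt.mpr fun x => (h1 x).continuousAt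
  induction N with
  | zero => simp
  | succ N ih =>
    have step := abs_integral_sub_trapezoid_le h1 h2 h3 hc (N * h) hh
    rw [show (N : ℝ) * h + h = ((N + 1 : ℕ) : ℝ) * h by push_cast; ring] at step
    rw [← integral_add_adjacent_intervals (hF.intervalIntegrable 0 (N * h))
        (hF.intervalIntegrable (N * h) ((N + 1 : ℕ) * h)),
      ← integral_add_adjacent_intervals (hc.abs.intervalIntegrable 0 (N * h))
        (hc.abs.intervalIntegrable (N * h) ((N + 1 : ℕ) * h)), Finset.sum_range_succ, mul_add]
    refine le_trans (le_of_eq ?_) ((abs_add_le _ _).trans (add_le_add ih step))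
    push_cast
    congr 1
    ring

/-- The Euler–Maclaurin formula of order three on the half-line. -/
theorem abs_tsum_sub_integral_le {F F₁ F₂ F₃ : ℝ → ℝ} (h1 : ∀ x, HasDerivAt F (F₁ x) x)
    (h2 : ∀ x, HasDerivAt F₁ (F₂ x) x) (h3 : ∀ x, HasDerivAt F₂ (F₃ x) x) (hc : Continuous F₃)
    (hi : IntegrableOn F (Ioi 0)) (hi₃ : IntegrableOn F₃ (Ioi 0)) {h : ℝ} (hh : 0 < h)
    (hs : Summable fun q : ℕ => F (q * h)) (hs₁ : Summable fun q : ℕ => F₁ (q * h)) :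
    |(∑' q : ℕ, h * F ((q + 1) * h)) -
        ((∫ x in Ioi (0 : ℝ), F x) - h * F 0 / 2 - h ^ 2 * F₁ 0 / 12)| ≤
      h ^ 3 * ∫ x in Ioi (0 : ℝ), |F₃ x| := by
  have ht : Tendsto (fun N : ℕ => (N : ℝ) * h) atTop atTop :=
    tendsto_natCast_atTop_atTop.atTop_mul_const hh
  have l1 := intervalIntegral_tendsto_integral_Ioi 0 hi ht
  have l3 := intervalIntegral_tendsto_integral_Ioi 0 hi₃.abs ht
  have hs' : Summable fun q : ℕ => h * F ((q + 1) * h) := by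
    have := ((summable_nat_add_iff 1).mpr hs).mul_left h
    simpa using this
  have l2 := hs'.hasSum.tendsto_sum_nat
  have l4 := hs.tendsto_atTop_zero
  have l5 := hs₁.tendsto_atTop_zero
  have lim := (((l1.sub l2).add (((l4.sub_const (F 0)).const_mul h).div_const 2)).add
    (((l5.sub_const (F₁ 0)).const_mul (h ^ 2)).div_const 12)).abs
  have := le_of_tendsto_of_tendsto' lim (l3.const_mul (h ^ 3))
    (abs_integral_sub_sum_le h1 h2 h3 hc hh.le)
  rw [abs_sub_comm]
  refine le_trans (le_of_eq ?_) this
  congr 1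
  ring

end EulerMaclaurin

/-! ### Riemann sums of polynomials times a Gaussian -/

section Gaussian

open Polynomial Set

/-- A polynomial times the Gaussian `exp (-x² / 2)`. -/
noncomputable def polyGauss (p : ℝ[X]) (x : ℝ) : ℝ := p.eval x * Real.exp (-x ^ 2 / 2)

theorem hasDerivAt_polyGauss (p : ℝ[X]) (x : ℝ) :
    HasDerivAt (polyGauss p) (polyGauss (derivative p - X * p) x) x := by
  have h := (p.hasDerivAt x).mul ((((hasDerivAt_id x).pow 2).neg.div_const 2).exp)
  refine h.congr_deriv ?_
  simp [polyGauss]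
  ring

theorem continuous_polyGauss (p : ℝ[X]) : Continuous (polyGauss p) :=
  continuous_iff_continuousAt.mpr fun x => (hasDerivAt_polyGauss p x).continuousAt

theorem polyGauss_add (p q : ℝ[X]) (x : ℝ) :
    polyGauss (p + q) x = polyGauss p x + polyGauss q x := by
  simp [polyGauss, add_mul]

theorem polyGauss_monomial (j : ℕ) (c x : ℝ) :
    polyGauss (monomial j c) x = c * (x ^ j * Real.exp (-x ^ 2 / 2)) := by
  simp [polyGauss, mul_assoc]

theorem pow_mul_gauss_eqOn (j : ℕ) :
    EqOn (fun x : ℝ => x ^ (j : ℝ) * Real.exp (-(1 / 2) * x ^ (2 : ℝ)))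
    (fun x : ℝ => x ^ j * Real.exp (-x ^ 2 / 2)) (Ioi 0) := by
  intro x _
  simp only [Real.rpow_natCast, Real.rpow_two]
  congr 2
  ring

theorem integrableOn_polyGauss (p : ℝ[X]) : IntegrableOn (polyGauss p) (Ioi 0) := by
  induction p using Polynomial.induction_on' with
  | add p q hp hq =>
    exact (hp.add hq).congr_fun (fun x _ => (polyGauss_add p q x).symm) measurableSet_Ioi
  | monomial j c =>
    have h : IntegrableOn (fun x : ℝ => x ^ (j : ℝ) * Real.exp (-(1 / 2) * x ^ (2 : ℝ))) (Ioi 0) :=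
      integrableOn_rpow_mul_exp_neg_mul_rpow (by have := j.cast_nonneg (α := ℝ); linarith)
        two_pos one_half_pos
    simp only [funext (polyGauss_monomial j c)]
    exact (h.congr_fun (pow_mul_gauss_eqOn j) measurableSet_Ioi).const_mul c

/-- The integral of a polynomial against `exp (-x² / 2)` on the positive half-line. -/
noncomputable def gaussIntegral (p : ℝ[X]) : ℝ := ∫ x in Ioi (0 : ℝ), polyGauss p x

theorem gaussIntegral_add (p q : ℝ[X]) :
    gaussIntegral (p + q) = gaussIntegral p + gaussIntegral q := by
  simp only [gaussIntegral, polyGauss_add]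
  exact integral_add (integrableOn_polyGauss p) (integrableOn_polyGauss q)

theorem gaussIntegral_monomial (j : ℕ) (c : ℝ) :
    gaussIntegral (monomial j c) = c * (√2 ^ (j + 1) / 2 * Real.Gamma (((j : ℝ) + 1) / 2)) := by
  have h := integral_rpow_mul_exp_neg_mul_rpow (p := 2) (q := j) (b := 1 / 2) two_pos
    (by have := j.cast_nonneg (α := ℝ); linarith) one_half_pos
  rw [setIntegral_congr_fun measurableSet_Ioi (pow_mul_gauss_eqOn j)] at h
  simp only [gaussIntegral, polyGauss_monomial]
  rw [integral_const_mul, h]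
  congr 2
  rw [one_div, Real.inv_rpow zero_le_two, ← Real.rpow_neg zero_le_two,
    Real.sqrt_eq_rpow, ← Real.rpow_natCast, ← Real.rpow_mul zero_le_two]
  push_cast
  rw [show -(-((j : ℝ) + 1) / 2) = 1 / 2 * ((j : ℝ) + 1) by ring]
  ring

theorem summable_polyGauss (p : ℝ[X]) {h : ℝ} (hh : 0 < h) :
    Summable fun q : ℕ => polyGauss p (q * h) := by
  induction p using Polynomial.induction_on' with
  | add p q hp hq => simpa only [polyGauss_add] using hp.add hq
  | monomial j c =>
    simp only [polyGauss_monomial]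
    refine Summable.mul_left c ?_
    refine Summable.of_nonneg_of_le (fun q => by positivity) (fun q => ?_)
      ((Real.summable_pow_mul_exp_neg_nat_mul j (r := h ^ 2 / 2) (by positivity)).mul_left (h ^ j))
    rw [mul_pow, mul_comm ((q : ℝ) ^ j), mul_assoc]
    have : (q : ℝ) ≤ (q : ℝ) ^ 2 := by exact_mod_cast Nat.le_self_pow two_ne_zero q
    gcongr
    nlinarith [sq_nonneg h]

/-- Polynomials times the Gaussian are closed under differentiation, which acts on the polynomial as
`D`. So the `L¹` norm of the third derivative is finite and serves as a constant independent of `h`.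
-/
theorem polyGauss_tsum_expansion (p : ℝ[X]) : ∃ C : ℝ, ∀ h : ℝ, 0 < h →
    |(∑' q : ℕ, h * polyGauss p ((q + 1) * h)) -
        (gaussIntegral p - h * p.coeff 0 / 2 - h ^ 2 * p.coeff 1 / 12)| ≤ C * h ^ 3 := by
  let D : ℝ[X] → ℝ[X] := fun q => derivative q - X * q
  refine ⟨∫ x in Ioi (0 : ℝ), |polyGauss (D (D (D p))) x|, fun h hh => ?_⟩
  have := abs_tsum_sub_integral_le (hasDerivAt_polyGauss p) (hasDerivAt_polyGauss _)
    (hasDerivAt_polyGauss _) (continuous_polyGauss _) (integrableOn_polyGauss p)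
    (integrableOn_polyGauss _) hh (summable_polyGauss _ hh) (summable_polyGauss _ hh)
  have e₀ : ∀ q : ℝ[X], polyGauss q 0 = q.coeff 0 := fun q => by
    simp [polyGauss, coeff_zero_eq_eval_zero]
  have e₁ : (derivative p - X * p).coeff 0 = p.coeff 1 := by simp [coeff_derivative]
  rw [e₀, e₀, e₁] at this
  exact this.trans_eq (mul_comm _ _)

end Gaussian

end BubbleSort

namespace BubbleSort

/-! ### Calculus of uniform polynomial bounds on the grid -/

section PolyBounded

/-- The mesh `1 / √n`. -/
noncomputable def mesh (n : ℕ) : ℝ := 1 / √(n : ℝ)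

/-- The grid point `q / √n`. -/
noncomputable def point (n q : ℕ) : ℝ := q * mesh n

theorem mesh_pos {n : ℕ} (hn : 1 ≤ n) : 0 < mesh n := by
  have : (0 : ℝ) < n := by exact_mod_cast hn
  exact one_div_pos.mpr (Real.sqrt_pos.mpr this)

theorem mesh_sq (n : ℕ) : mesh n ^ 2 = 1 / n := by
  rw [mesh, div_pow, Real.sq_sqrt n.cast_nonneg, one_pow]

theorem mesh_le_one {n : ℕ} (hn : 1 ≤ n) : mesh n ≤ 1 := by
  have h1 : (1 : ℝ) ≤ n := by exact_mod_cast hn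
  have h2 : 1 ≤ √(n : ℝ) := Real.one_le_sqrt.mpr h1
  exact (div_le_one (by linarith)).mpr h2

theorem point_nonneg (n q : ℕ) : 0 ≤ point n q := by
  unfold point mesh
  positivity

theorem point_sq (n q : ℕ) : point n q ^ 2 = (q : ℝ) ^ 2 / n := by
  rw [point, mul_pow, mesh_sq]
  ring

/-- On the pairs `(n, q)` in `S` with `n ≥ 1`, the function `f` grows at most like a power of
`1 + q / √n`, uniformly in `n`. -/
def PolyBounded (S : ℕ → ℕ → Prop) (f : ℕ → ℕ → ℝ) : Prop :=
  ∃ (C : ℝ) (N : ℕ), ∀ n q, 1 ≤ n → S n q → |f n q| ≤ C * (1 + point n q) ^ N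

variable {S T : ℕ → ℕ → Prop} {f g : ℕ → ℕ → ℝ}

theorem PolyBounded.exists_nonneg (hf : PolyBounded S f) :
    ∃ (C : ℝ) (N : ℕ), 0 ≤ C ∧ ∀ n q, 1 ≤ n → S n q → |f n q| ≤ C * (1 + point n q) ^ N := by
  obtain ⟨C, N, h⟩ := hf
  refine ⟨|C|, N, abs_nonneg _, fun n q hn hS => (h n q hn hS).trans ?_⟩
  have := point_nonneg n q
  gcongr
  exact le_abs_self C

theorem PolyBounded.mono (hg : PolyBounded S g)
    (h : ∀ n q, 1 ≤ n → S n q → |f n q| ≤ |g n q|) : PolyBounded S f := by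
  obtain ⟨C, N, hC⟩ := hg
  exact ⟨C, N, fun n q hn hS => (h n q hn hS).trans (hC n q hn hS)⟩

theorem PolyBounded.congr (hg : PolyBounded S g)
    (h : ∀ n q, 1 ≤ n → S n q → f n q = g n q) : PolyBounded S f :=
  hg.mono fun n q hn hS => (congrArg _ (h n q hn hS)).le

theorem PolyBounded.const (c : ℝ) : PolyBounded S fun _ _ => c :=
  ⟨|c|, 0, fun n q _ _ => by simp⟩

theorem PolyBounded.point : PolyBounded S point :=
  ⟨1, 1, fun n q _ _ => by
    have := point_nonneg n q
    rw [abs_of_nonneg this]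
    linarith⟩

theorem PolyBounded.mesh : PolyBounded S fun n _ => mesh n :=
  ⟨1, 0, fun n q hn _ => by
    rw [abs_of_pos (mesh_pos hn)]
    simpa using mesh_le_one hn⟩

theorem PolyBounded.add (hf : PolyBounded S f) (hg : PolyBounded S g) :
    PolyBounded S fun n q => f n q + g n q := by
  obtain ⟨C, N, hC, h⟩ := hf.exists_nonneg
  obtain ⟨C', N', hC', h'⟩ := hg.exists_nonneg
  refine ⟨C + C', N + N', fun n q hn hS => (abs_add_le _ _).trans ?_⟩
  have hx := point_nonneg n q
  rw [add_mul]
  refine add_le_add ((h n q hn hS).trans ?_) ((h' n q hn hS).trans ?_)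
  · exact mul_le_mul_of_nonneg_left (pow_le_pow_right₀ (by linarith) (by omega)) hC
  · exact mul_le_mul_of_nonneg_left (pow_le_pow_right₀ (by linarith) (by omega)) hC'

theorem PolyBounded.mul (hf : PolyBounded S f) (hg : PolyBounded S g) :
    PolyBounded S fun n q => f n q * g n q := by
  obtain ⟨C, N, hC, h⟩ := hf.exists_nonneg
  obtain ⟨C', N', hC', h'⟩ := hg.exists_nonneg
  refine ⟨C * C', N + N', fun n q hn hS => ?_⟩
  have hx := point_nonneg n q
  rw [abs_mul, pow_add, mul_mul_mul_comm]
  exact mul_le_mul (h n q hn hS) (h' n q hn hS) (abs_nonneg _) (by positivity)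

theorem PolyBounded.neg (hf : PolyBounded S f) : PolyBounded S fun n q => -f n q :=
  hf.mono fun _ _ _ _ => (abs_neg _).le

theorem PolyBounded.abs (hf : PolyBounded S f) : PolyBounded S fun n q => |f n q| :=
  hf.mono fun _ _ _ _ => (abs_abs _).le

theorem PolyBounded.sub (hf : PolyBounded S f) (hg : PolyBounded S g) :
    PolyBounded S fun n q => f n q - g n q := by
  simpa only [sub_eq_add_neg] using hf.add hg.neg

theorem PolyBounded.div_const (hf : PolyBounded S f) (c : ℝ) :
    PolyBounded S fun n q => f n q / c := by
  simpa only [div_eq_mul_inv] using hf.mul (.const c⁻¹)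

theorem PolyBounded.pow (hf : PolyBounded S f) (m : ℕ) : PolyBounded S fun n q => f n q ^ m := by
  induction m with
  | zero => simpa using PolyBounded.const 1
  | succ m ih => simpa only [pow_succ] using ih.mul hf

theorem PolyBounded.cases (hf : PolyBounded S f) (hf' : PolyBounded (fun n q => ¬S n q) f) :
    PolyBounded T f := by
  obtain ⟨C, N, hC, h⟩ := hf.exists_nonneg
  obtain ⟨C', N', hC', h'⟩ := hf'.exists_nonneg
  refine ⟨C + C', N + N', fun n q hn _ => ?_⟩
  have hx := point_nonneg n q
  by_cases hS : S n q
  · exact (h n q hn hS).trans (mul_le_mul (by linarith)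
      (pow_le_pow_right₀ (by linarith) (by omega)) (by positivity) (by positivity))
  · exact (h' n q hn hS).trans (mul_le_mul (by linarith)
      (pow_le_pow_right₀ (by linarith) (by omega)) (by positivity) (by positivity))

end PolyBounded

/-! ### Second-order expansion of the tail probabilities -/

section Survival

theorem survival_succ {n q : ℕ} (hq : q < n) :
    survival n (q + 1) = survival n q * (1 - 1 / ((n : ℝ) - q)) ^ (q + 1) := by
  obtain ⟨m, rfl⟩ : ∃ m, n = m + 1 + q := ⟨n - 1 - q, by omega⟩
  have e1 : m + 1 + q - (q + 1) = m := by omega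
  have e2 : m + 1 + q - q = m + 1 := by omega
  have e3 : (1 : ℝ) - 1 / (((m + 1 + q : ℕ) : ℝ) - q) = m / (m + 1) := by
    push_cast
    rw [add_sub_cancel_right]
    field_simp
    ring
  rw [survival, survival, e1, e2, e3, Nat.factorial_succ, div_pow]
  push_cast
  field_simp
  ring

theorem survival_nonneg (n q : ℕ) : 0 ≤ survival n q := by
  unfold survival
  positivity

theorem survival_pos {n q : ℕ} (hq : q < n) : 0 < survival n q := by
  have : 0 < n - q := by omega
  unfold survival
  positivity

theorem survival_zero (n : ℕ) : survival n 0 = 1 := by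
  have : (n.factorial : ℝ) ≠ 0 := by positivity
  simp [survival, this]

/-- Each ratio is at most `exp (-(q + 1) / n)`, and these exponents add up to at most `-q² / (2n)`.
The bound gives the sign needed in `abs_exp_neg_sub_le` and controls the range `2 * q > n`. -/
theorem survival_le_exp {n : ℕ} (hn : 1 ≤ n) (q : ℕ) :
    survival n q ≤ Real.exp (-point n q ^ 2 / 2) := by
  have hn0 : (0 : ℝ) < n := by exact_mod_cast hn
  induction q with
  | zero => simp [survival_zero, point]
  | succ q ih =>
    by_cases hq : q < n
    · have hq' : (q : ℝ) + 1 ≤ n := by exact_mod_cast hq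
      have h1 : (1 : ℝ) / ((n : ℝ) - q) ≤ 1 := (div_le_one (by linarith)).mpr (by linarith)
      have h2 : 1 / (n : ℝ) ≤ 1 / ((n : ℝ) - q) :=
        one_div_le_one_div_of_le (by linarith) (by have := q.cast_nonneg (α := ℝ); linarith)
      have h3 : 1 - 1 / ((n : ℝ) - q) ≤ Real.exp (-(1 / (n : ℝ))) := by
        have := Real.add_one_le_exp (-(1 / (n : ℝ)))
        linarith
      rw [survival_succ hq]
      calc _ ≤ Real.exp (-point n q ^ 2 / 2) * Real.exp (-(1 / (n : ℝ))) ^ (q + 1) := by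
            have := survival_nonneg n q
            gcongr
        _ ≤ _ := by
            rw [← Real.exp_nat_mul, ← Real.exp_add, Real.exp_le_exp, point_sq, point_sq]
            push_cast
            rw [← sub_nonneg]
            have : -(((q : ℝ) + 1) ^ 2 / n) / 2 - (-((q : ℝ) ^ 2 / n) / 2 +
              ((q : ℝ) + 1) * -(1 / n)) = 1 / (2 * n) := by field_simp; ring
            rw [this]
            positivity
    · rw [survival_of_le hn (by omega)]
      positivity

/-- The terms of `-log (survival n q)` up to an error that is cubic in `1 / √n`. -/
noncomputable def logSurvivalMain (n q : ℝ) : ℝ :=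
  q * (q + 1) / (2 * n) + q ^ 3 / (3 * n ^ 2) + (q ^ 4 / n ^ 3 + q ^ 2 / n ^ 2) / 4

theorem abs_log_increment_le {n q : ℝ} (hq : 0 ≤ q) (hqn : 2 * (q + 1) ≤ n) :
    |-((q + 1) * Real.log (1 - 1 / (n - q))) - (logSurvivalMain n (q + 1) - logSurvivalMain n q)| ≤
      20 * (1 / n ^ 2 + (q + 1) ^ 2 / n ^ 3 + (q + 1) ^ 4 / n ^ 4) := by
  have hn : 0 < n := by linarith
  have hnq : 0 < n - q := by linarith
  obtain ⟨y, hy⟩ : ∃ y, y = 1 / (n - q) := ⟨_, rfl⟩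
  have hy0 : 0 < y := hy ▸ one_div_pos.mpr hnq
  have hy1 : y ≤ 2 / n := by
    rw [hy, div_le_div_iff₀ hnq hn]
    linarith
  have hy2 : y ≤ 1 / 2 := by
    rw [hy]
    exact one_div_le_one_div_of_le two_pos (by linarith)
  have hlog : |y + y ^ 2 / 2 + Real.log (1 - y)| ≤ 16 / n ^ 3 := by
    have h := Real.abs_log_sub_add_sum_range_le (x := y) (by rw [abs_of_pos hy0]; linarith) 2
    rw [abs_of_pos hy0] at h
    norm_num [Finset.sum_range_succ] at h
    refine h.trans ?_
    have h2 : y ^ 3 ≤ (2 / n) ^ 3 := pow_le_pow_left₀ hy0.le hy1 3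
    rw [div_le_iff₀ (by linarith)]
    have h3 : (2 / n) ^ 3 = 16 / n ^ 3 * (1 / 2) := by field_simp; norm_num
    rw [h3] at h2
    refine h2.trans ?_
    have : 0 < 16 / n ^ 3 := by positivity
    nlinarith
  -- An exact identity: `y (n - q) = 1` expands `y` and `y²` in powers of `1 / n` with explicit
  -- remainders.
  have e1 : -((q + 1) * Real.log (1 - y)) - (logSurvivalMain n (q + 1) - logSurvivalMain n q) =
      -((q + 1) * (y + y ^ 2 / 2 + Real.log (1 - y))) +
        (-(1 / (12 * n ^ 2)) - (q ^ 2 / 2 + q + 1 / 4) / n ^ 3 +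
          (q + 1) * (q ^ 3 * y / n ^ 3 + q * y / n * (y + 1 / n) / 2)) := by
    have hyn : y * (n - q) = 1 := by rw [hy]; field_simp
    have f1 : y = 1 / n + q / n ^ 2 + q ^ 2 / n ^ 3 + q ^ 3 * y / n ^ 3 := by
      field_simp
      linear_combination (n ^ 2 + n * q + q ^ 2) * hyn
    have f2 : y ^ 2 = 1 / n ^ 2 + q * y / n * (y + 1 / n) := by
      field_simp
      linear_combination (1 + n * y) * hyn
    have f3 : logSurvivalMain n (q + 1) - logSurvivalMain n q =
        (q + 1) * (1 / n + q / n ^ 2 + q ^ 2 / n ^ 3 + 1 / (2 * n ^ 2)) +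
          1 / (12 * n ^ 2) + (q ^ 2 / 2 + q + 1 / 4) / n ^ 3 := by
      unfold logSurvivalMain
      field_simp
      ring
    rw [f3]
    linear_combination (q + 1) * f1 + (q + 1) / 2 * f2
  rw [← hy, e1]
  have g1 : |(q + 1) * (y + y ^ 2 / 2 + Real.log (1 - y))| ≤ 16 * ((q + 1) ^ 2 / n ^ 3) := by
    rw [abs_mul, abs_of_pos (by linarith : 0 < q + 1)]
    calc _ ≤ (q + 1) * (16 / n ^ 3) := by gcongr
      _ ≤ (q + 1) ^ 2 * (16 / n ^ 3) := by
          have : q + 1 ≤ (q + 1) ^ 2 := by nlinarith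
          gcongr
      _ = _ := by ring
  have g2 : (q + 1) * (q ^ 3 * y / n ^ 3) ≤ 2 * ((q + 1) ^ 4 / n ^ 4) := by
    calc _ ≤ (q + 1) * ((q + 1) ^ 3 * (2 / n) / n ^ 3) := by gcongr; linarith
      _ = _ := by field_simp
  have g3 : (q + 1) * (q * y / n * (y + 1 / n) / 2) ≤ 3 * ((q + 1) ^ 2 / n ^ 3) := by
    calc _ ≤ (q + 1) * ((q + 1) * (2 / n) / n * (2 / n + 1 / n) / 2) := by gcongr; linarith
      _ = _ := by field_simp; norm_num
  have g4 : (q ^ 2 / 2 + q + 1 / 4) / n ^ 3 ≤ (q + 1) ^ 2 / n ^ 3 := by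
    gcongr
    nlinarith
  have g5 : 1 / (12 * n ^ 2) ≤ 1 / n ^ 2 := by
    apply one_div_le_one_div_of_le (by positivity)
    nlinarith [sq_nonneg n]
  have p1 : 0 ≤ 1 / (12 * n ^ 2) := by positivity
  have p2 : 0 ≤ (q ^ 2 / 2 + q + 1 / 4) / n ^ 3 := by positivity
  have p3 : 0 ≤ (q + 1) * (q ^ 3 * y / n ^ 3) := by positivity
  have p4 : 0 ≤ (q + 1) * (q * y / n * (y + 1 / n) / 2) := by positivity
  have p5 : 0 ≤ 1 / n ^ 2 := by positivity
  have p6 : 0 ≤ (q + 1) ^ 2 / n ^ 3 := by positivity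
  have p7 : 0 ≤ (q + 1) ^ 4 / n ^ 4 := by positivity
  rw [mul_add (q + 1)]
  rw [abs_le] at g1 ⊢
  constructor <;> linarith [g1.1, g1.2]

theorem abs_log_survival_le {n Q : ℕ} (hQ : 2 * Q ≤ n) :
    |-Real.log (survival n Q) - logSurvivalMain n Q| ≤
      Q * (20 * (1 / (n : ℝ) ^ 2 + (Q : ℝ) ^ 2 / (n : ℝ) ^ 3 + (Q : ℝ) ^ 4 / (n : ℝ) ^ 4)) := by
  -- The per-step error is frozen at its value for `Q`, so the bound grows linearly along the
  -- induction.
  have key : ∀ q : ℕ, q ≤ Q → |-Real.log (survival n q) - logSurvivalMain n q| ≤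
      q * (20 * (1 / (n : ℝ) ^ 2 + (Q : ℝ) ^ 2 / (n : ℝ) ^ 3 + (Q : ℝ) ^ 4 / (n : ℝ) ^ 4)) := by
    intro q
    induction q with
    | zero => simp [survival_zero, logSurvivalMain]
    | succ q ih =>
      intro hq
      have hqn : 2 * ((q : ℝ) + 1) ≤ n := by exact_mod_cast (by omega : 2 * (q + 1) ≤ n)
      have hq0 := q.cast_nonneg (α := ℝ)
      have hqQ : (q : ℝ) + 1 ≤ Q := by exact_mod_cast hq
      have h1 := abs_log_increment_le hq0 hqn
      have h2 : 20 * (1 / (n : ℝ) ^ 2 + ((q : ℝ) + 1) ^ 2 / (n : ℝ) ^ 3 +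
          ((q : ℝ) + 1) ^ 4 / (n : ℝ) ^ 4) ≤
          20 * (1 / (n : ℝ) ^ 2 + (Q : ℝ) ^ 2 / (n : ℝ) ^ 3 + (Q : ℝ) ^ 4 / (n : ℝ) ^ 4) := by
        gcongr
      have hpos : 0 < 1 - 1 / ((n : ℝ) - q) := by
        rw [sub_pos, div_lt_one (by linarith)]
        linarith
      rw [survival_succ (by omega), Real.log_mul (survival_pos (by omega)).ne' (by positivity),
        Real.log_pow]
      push_cast
      refine le_trans (le_of_eq ?_) (((abs_add_le _ _).trans (add_le_add (ih (by omega))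
        (h1.trans h2))).trans_eq (by ring))
      congr 1
      ring
  exact key Q le_rfl

theorem abs_exp_neg_sub_le {u : ℝ} (hu : 0 ≤ u) :
    |Real.exp (-u) - (1 - u + u ^ 2 / 2)| ≤ 4 * u ^ 3 := by
  by_cases h1 : u ≤ 1
  · have h := Real.exp_bound (x := -u) (by rwa [abs_neg, abs_of_nonneg hu]) (n := 3) (by norm_num)
    rw [abs_neg, abs_of_nonneg hu] at h
    norm_num [Finset.sum_range_succ, Nat.factorial] at h
    have h3 : 0 ≤ u ^ 3 := by positivity
    rw [← sub_eq_add_neg] at h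
    refine h.trans ?_
    linarith
  · have h2 : Real.exp (-u) ≤ 1 := Real.exp_le_one_iff.mpr (by linarith)
    have h3 := Real.exp_pos (-u)
    rw [abs_le]
    constructor <;> nlinarith [sq_nonneg (u - 1), mul_nonneg hu (sq_nonneg (u - 1))]

/-- The coefficient of `-1 / √n` in the expansion of `survival n q` at `x = q / √n`. -/
noncomputable def firstCorrection (x : ℝ) : ℝ := x / 2 + x ^ 3 / 3

/-- The coefficient of `1 / n` in the expansion of `-log (survival n q)` at `x = q / √n`. -/
noncomputable def secondCorrection (x : ℝ) : ℝ := (x ^ 4 + x ^ 2) / 4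

theorem polyBounded_firstCorrection {S : ℕ → ℕ → Prop} :
    PolyBounded S fun n q => firstCorrection (point n q) :=
  (PolyBounded.point.div_const 2).add ((PolyBounded.point.pow 3).div_const 3)

theorem polyBounded_secondCorrection {S : ℕ → ℕ → Prop} :
    PolyBounded S fun n q => secondCorrection (point n q) :=
  ((PolyBounded.point.pow 4).add (PolyBounded.point.pow 2)).div_const 4

/-- The expansion of `survival n q`, divided by the Gaussian, up to the second order. -/
noncomputable def survivalMain (n q : ℕ) : ℝ :=
  1 - mesh n * firstCorrection (point n q) +
    mesh n ^ 2 * (firstCorrection (point n q) ^ 2 / 2 - secondCorrection (point n q))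

theorem polyBounded_survivalMain {S : ℕ → ℕ → Prop} : PolyBounded S survivalMain :=
  ((PolyBounded.const 1).sub (PolyBounded.mesh.mul polyBounded_firstCorrection)).add
    ((PolyBounded.mesh.pow 2).mul
      (((polyBounded_firstCorrection.pow 2).div_const 2).sub polyBounded_secondCorrection))

theorem logSurvivalMain_eq {n : ℕ} (hn : 1 ≤ n) (q : ℕ) :
    logSurvivalMain n q = point n q ^ 2 / 2 + mesh n * firstCorrection (point n q) +
      mesh n ^ 2 * secondCorrection (point n q) := by
  have hn0 : (n : ℝ) ≠ 0 := by positivity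
  have e : logSurvivalMain n q = (q : ℝ) * (q + 1) * (1 / n) / 2 + (q : ℝ) ^ 3 * (1 / n) ^ 2 / 3 +
      ((q : ℝ) ^ 4 * (1 / n) ^ 3 + (q : ℝ) ^ 2 * (1 / n) ^ 2) / 4 := by
    unfold logSurvivalMain
    field_simp
  rw [e, ← mesh_sq]
  simp only [firstCorrection, secondCorrection, point]
  ring

/-- The remainder in the expansion of `survival n q`. -/
noncomputable def survivalRem (n q : ℕ) : ℝ :=
  (survival n q / Real.exp (-point n q ^ 2 / 2) - survivalMain n q) / mesh n ^ 3

theorem survival_eq {n : ℕ} (hn : 1 ≤ n) (q : ℕ) :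
    survival n q =
      Real.exp (-point n q ^ 2 / 2) * (survivalMain n q + mesh n ^ 3 * survivalRem n q) := by
  have := mesh_pos hn
  have := Real.exp_pos (-point n q ^ 2 / 2)
  unfold survivalRem
  field_simp
  ring

/-- Here `u` is nonnegative and equals `h` times a polynomially bounded factor, so cutting `exp
(-u)` after `u² / 2` costs `h³` times such a factor, even where `u` is large. -/
theorem polyBounded_survivalRem_of_le : PolyBounded (fun n q => 2 * q ≤ n) survivalRem := by
  set u : ℕ → ℕ → ℝ := fun n q => -Real.log (survival n q) - point n q ^ 2 / 2 with hu
  set r : ℕ → ℕ → ℝ := fun n q => (-Real.log (survival n q) - logSurvivalMain n q) / mesh n ^ 3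
    with hr
  have hu_eq : ∀ n q, 1 ≤ n → u n q = mesh n * (firstCorrection (point n q) +
      mesh n * secondCorrection (point n q) + mesh n ^ 2 * r n q) := by
    intro n q hn
    have := mesh_pos hn
    simp only [hu, hr, logSurvivalMain_eq hn]
    field_simp
    ring
  have hr_bdd : PolyBounded (fun n q => 2 * q ≤ n) r := by
    refine ((PolyBounded.const 20).mul ((PolyBounded.point.add (PolyBounded.point.pow 3)).add
      (PolyBounded.point.pow 5))).mono fun n q hn hq => ?_
    have h := abs_log_survival_le hq
    have hm := mesh_pos hn
    have hn0 : (n : ℝ) ≠ 0 := by positivity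
    have hx := point_nonneg n q
    rw [hr, abs_div, abs_of_pos (pow_pos hm 3), div_le_iff₀ (pow_pos hm 3),
      abs_of_nonneg (by positivity : 0 ≤ 20 * (point n q + point n q ^ 3 + point n q ^ 5))]
    refine h.trans (le_of_eq ?_)
    have e : (q : ℝ) * (20 * (1 / (n : ℝ) ^ 2 + (q : ℝ) ^ 2 / (n : ℝ) ^ 3 +
        (q : ℝ) ^ 4 / (n : ℝ) ^ 4)) = q * (20 * ((1 / (n : ℝ)) ^ 2 +
        (q : ℝ) ^ 2 * (1 / (n : ℝ)) ^ 3 + (q : ℝ) ^ 4 * (1 / (n : ℝ)) ^ 4)) := by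
      field_simp
    rw [e, ← mesh_sq, point]
    ring
  have hv_bdd : PolyBounded (fun n q => 2 * q ≤ n) fun n q => firstCorrection (point n q) +
      mesh n * secondCorrection (point n q) + mesh n ^ 2 * r n q :=
    (polyBounded_firstCorrection.add (PolyBounded.mesh.mul polyBounded_secondCorrection)).add
      ((PolyBounded.mesh.pow 2).mul hr_bdd)
  have h_exp : PolyBounded (fun n q => 2 * q ≤ n) fun n q =>
      (Real.exp (-u n q) - (1 - u n q + u n q ^ 2 / 2)) / mesh n ^ 3 := by
    refine ((PolyBounded.const 4).mul (hv_bdd.pow 3)).mono fun n q hn hq => ?_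
    have hm := mesh_pos hn
    have hu0 : 0 ≤ u n q := by
      have h1 := survival_pos (by omega : q < n)
      have h2 := Real.log_le_log h1 (survival_le_exp hn q)
      rw [Real.log_exp] at h2
      simp only [hu]
      linarith
    have h := abs_exp_neg_sub_le hu0
    rw [abs_div, abs_of_pos (pow_pos hm 3), div_le_iff₀ (pow_pos hm 3)]
    refine h.trans ((le_abs_self _).trans (le_of_eq ?_))
    rw [← abs_of_pos (pow_pos hm 3), ← abs_mul, hu_eq n q hn]
    congr 1
    ring
  -- Beyond the exponential error, `-u` leaves `-r`, and `u² / 2` leaves `((A + hY)² - A²) / (2h) =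
  -- Y (2A + hY) / 2` with `Y = B + h r`.
  refine (h_exp.add (hr_bdd.neg.add (((polyBounded_secondCorrection.add
    (PolyBounded.mesh.mul hr_bdd)).mul (((polyBounded_firstCorrection.add
      polyBounded_firstCorrection).add (PolyBounded.mesh.mul polyBounded_secondCorrection)).add
        ((PolyBounded.mesh.pow 2).mul hr_bdd))).div_const 2))).congr fun n q hn hq => ?_
  have hm := mesh_pos hn
  have e : survival n q / Real.exp (-point n q ^ 2 / 2) = Real.exp (-u n q) := by
    nth_rewrite 1 [← Real.exp_log (survival_pos (by omega : q < n))]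
    rw [← Real.exp_sub]
    congr 1
    simp only [hu]
    ring
  rw [survivalRem, e, div_eq_iff (pow_pos hm 3).ne', add_mul, div_mul_cancel₀ _ (pow_pos hm 3).ne',
    hu_eq n q hn, survivalMain]
  ring

/-- For `2 * q > n` one has `h x > 1 / 2`, hence `1 ≤ 8 x³ h³`: a polynomially bounded quantity is
already `h³` times one. -/
theorem polyBounded_survivalRem : PolyBounded (fun _ _ => True) survivalRem := by
  refine polyBounded_survivalRem_of_le.cases ?_
  refine (((PolyBounded.const 1).add polyBounded_survivalMain.abs).mul ((PolyBounded.const 8).mul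
    (PolyBounded.point.pow 3))).mono fun n q hn hq => ?_
  have hm := mesh_pos hn
  have hn0 : (0 : ℝ) < n := by exact_mod_cast hn
  have hx := point_nonneg n q
  rw [survivalRem, abs_div, abs_of_pos (pow_pos hm 3), div_le_iff₀ (pow_pos hm 3),
    abs_of_nonneg (by positivity :
      0 ≤ (1 + |survivalMain n q|) * (8 * point n q ^ 3))]
  have h1 : 1 ≤ 2 * (mesh n * point n q) := by
    have : mesh n * point n q = q / n := by
      rw [point, mul_left_comm, ← sq, mesh_sq]; ring
    rw [this, ← mul_div_assoc, le_div_iff₀ hn0, one_mul]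
    exact_mod_cast (not_le.mp hq).le
  have h2 : 1 ≤ 8 * point n q ^ 3 * mesh n ^ 3 := by
    have := one_le_pow₀ h1 (n := 3)
    refine this.trans (le_of_eq ?_)
    ring
  have h3 : |survival n q / Real.exp (-point n q ^ 2 / 2)| ≤ 1 := by
    rw [abs_of_nonneg (div_nonneg (survival_nonneg n q) (Real.exp_pos _).le)]
    exact (div_le_one (Real.exp_pos _)).mpr (survival_le_exp hn q)
  have h4 : 0 ≤ 1 + |survivalMain n q| := by positivity
  calc _ ≤ |survival n q / Real.exp (-point n q ^ 2 / 2)| + |survivalMain n q| := abs_sub _ _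
    _ ≤ 1 + |survivalMain n q| := by linarith
    _ ≤ (1 + |survivalMain n q|) * (8 * point n q ^ 3 * mesh n ^ 3) :=
        le_mul_of_one_le_right h4 h2
    _ = _ := by ring

end Survival

end BubbleSort

namespace BubbleSort

/-! ### Summing the expansion over the grid -/

section Sums

open Polynomial

/-- The remainder of fourth order in the expansion of `(x - h) ^ k`. -/
def powSubRem (h x : ℝ) : ℕ → ℝ
  | 0 => 0
  | k + 1 => (x - h) * powSubRem h x k + k.choose 3 * x ^ (k - 3)

theorem mul_choose_mul_pow (k m : ℕ) (x : ℝ) :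
    x * (k.choose (m + 1) * x ^ (k - (m + 1))) + k.choose m * x ^ (k - m) =
      (k + 1).choose (m + 1) * x ^ (k + 1 - (m + 1)) := by
  rw [Nat.choose_succ_succ, Nat.add_sub_add_right]
  by_cases h : m + 1 ≤ k
  · rw [show k - m = k - (m + 1) + 1 by omega]
    push_cast
    ring
  · rw [Nat.choose_eq_zero_of_lt (by omega : k < m + 1)]
    simp

theorem sub_pow_expansion (h x : ℝ) (k : ℕ) :
    (x - h) ^ k = x ^ k - h * (k.choose 1 * x ^ (k - 1)) + h ^ 2 * (k.choose 2 * x ^ (k - 2)) -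
      h ^ 3 * (k.choose 3 * x ^ (k - 3)) + h ^ 4 * powSubRem h x k := by
  induction k with
  | zero => simp [powSubRem]
  | succ k ih =>
    rw [pow_succ, ih, ← mul_choose_mul_pow k 0, ← mul_choose_mul_pow k 1, ← mul_choose_mul_pow k 2,
      powSubRem]
    simp only [zero_add, Nat.reduceAdd, Nat.choose_zero_right, Nat.sub_zero]
    push_cast
    ring

theorem polyBounded_powSubRem {S : ℕ → ℕ → Prop} (k : ℕ) :
    PolyBounded S fun n q => powSubRem (mesh n) (point n q) k := by
  induction k with
  | zero => exact .const 0
  | succ k ih =>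
    exact ((PolyBounded.point.sub PolyBounded.mesh).mul ih).add
      ((PolyBounded.const _).mul (PolyBounded.point.pow _))

theorem point_succ (n q : ℕ) : point n (q + 1) = ((q : ℝ) + 1) * mesh n := by
  simp [point]

/-- The terms are dominated by the Riemann sum of one fixed polynomial times the Gaussian, which is
bounded uniformly in `h ≤ 1`. -/
theorem exists_abs_tsum_le {f : ℕ → ℕ → ℝ} (hf : PolyBounded (fun _ _ => True) f) :
    ∃ C : ℝ, ∀ n, 1 ≤ n →
      (Summable fun q : ℕ =>
        mesh n * (Real.exp (-point n (q + 1) ^ 2 / 2) * f n (q + 1))) ∧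
      |∑' q : ℕ, mesh n * (Real.exp (-point n (q + 1) ^ 2 / 2) * f n (q + 1))| ≤ C := by
  obtain ⟨C, N, hC, h⟩ := hf.exists_nonneg
  set p : ℝ[X] := Polynomial.C C * (1 + X) ^ N with hp
  obtain ⟨B, hB⟩ := polyGauss_tsum_expansion p
  refine ⟨|B| + (|gaussIntegral p| + |p.coeff 0| + |p.coeff 1|), fun n hn => ?_⟩
  have hm := mesh_pos hn
  have hm1 := mesh_le_one hn
  have hle : ∀ q : ℕ, ‖mesh n * (Real.exp (-point n (q + 1) ^ 2 / 2) * f n (q + 1))‖ ≤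
      mesh n * polyGauss p (((q : ℝ) + 1) * mesh n) := by
    intro q
    rw [Real.norm_eq_abs, abs_mul, abs_mul, abs_of_pos hm, abs_of_pos (Real.exp_pos _),
      ← point_succ, polyGauss, mul_comm (Real.exp _)]
    have := h n (q + 1) hn trivial
    gcongr
    simpa [hp] using this
  have hs : Summable fun q : ℕ => mesh n * polyGauss p (((q : ℝ) + 1) * mesh n) := by
    have := ((summable_nat_add_iff 1).mpr (summable_polyGauss p hm)).mul_left (mesh n)
    simpa using this
  refine ⟨.of_norm_bounded hs hle, ?_⟩
  have h1 := tsum_of_norm_bounded hs.hasSum hle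
  rw [Real.norm_eq_abs] at h1
  have h2 := (abs_le.mp (hB (mesh n) hm)).2
  have h3 : B * mesh n ^ 3 ≤ |B| := by
    have a : mesh n ^ 3 ≤ 1 := pow_le_one₀ hm.le hm1
    have b : 0 < mesh n ^ 3 := by positivity
    nlinarith [le_abs_self B, abs_nonneg B]
  have h4 : -(mesh n * p.coeff 0) ≤ |p.coeff 0| := by
    nlinarith [neg_abs_le (p.coeff 0), abs_nonneg (p.coeff 0)]
  have h5 : -(mesh n ^ 2 * p.coeff 1) ≤ |p.coeff 1| := by
    have a : mesh n ^ 2 ≤ 1 := pow_le_one₀ hm.le hm1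
    have b : 0 < mesh n ^ 2 := by positivity
    nlinarith [neg_abs_le (p.coeff 1), abs_nonneg (p.coeff 1)]
  have h6 := le_abs_self (gaussIntegral p)
  have h7 := abs_nonneg (p.coeff 0)
  have h8 := abs_nonneg (p.coeff 1)
  linarith

theorem tsum_expansion {g R : ℕ → ℕ → ℝ} {P₀ P₁ P₂ : ℝ[X]} (hR : PolyBounded (fun _ _ => True) R)
    (hg : ∀ n q, 1 ≤ n → g n q = P₀.eval (point n q) + mesh n * P₁.eval (point n q) +
      mesh n ^ 2 * P₂.eval (point n q) + mesh n ^ 3 * R n q) :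
    ∃ C : ℝ, ∀ n, 1 ≤ n →
      |(∑' q : ℕ, mesh n * (Real.exp (-point n (q + 1) ^ 2 / 2) * g n (q + 1))) -
        (gaussIntegral P₀ + mesh n * (gaussIntegral P₁ - P₀.coeff 0 / 2) +
          mesh n ^ 2 * (gaussIntegral P₂ - P₁.coeff 0 / 2 - P₀.coeff 1 / 12))| ≤
        C * mesh n ^ 3 := by
  obtain ⟨B, hB⟩ := exists_abs_tsum_le hR
  obtain ⟨C₀, h₀⟩ := polyGauss_tsum_expansion P₀
  obtain ⟨C₁, h₁⟩ := polyGauss_tsum_expansion P₁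
  obtain ⟨C₂, h₂⟩ := polyGauss_tsum_expansion P₂
  refine ⟨B + C₀ + |C₁| + |C₂| + |P₁.coeff 1| + |P₂.coeff 0| + |P₂.coeff 1|, fun n hn => ?_⟩
  have hm := mesh_pos hn
  have hm1 := mesh_le_one hn
  obtain ⟨hs, hb⟩ := hB n hn
  have hsum : ∀ p : ℝ[X], Summable fun q : ℕ => mesh n * polyGauss p (((q : ℝ) + 1) * mesh n) := by
    intro p
    have := ((summable_nat_add_iff 1).mpr (summable_polyGauss p hm)).mul_left (mesh n)
    simpa using this
  have e : ∑' q : ℕ, mesh n * (Real.exp (-point n (q + 1) ^ 2 / 2) * g n (q + 1)) =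
      (∑' q : ℕ, mesh n * polyGauss P₀ (((q : ℝ) + 1) * mesh n)) +
      mesh n * (∑' q : ℕ, mesh n * polyGauss P₁ (((q : ℝ) + 1) * mesh n)) +
      mesh n ^ 2 * (∑' q : ℕ, mesh n * polyGauss P₂ (((q : ℝ) + 1) * mesh n)) +
      mesh n ^ 3 * ∑' q : ℕ, mesh n * (Real.exp (-point n (q + 1) ^ 2 / 2) * R n (q + 1)) := by
    rw [← tsum_mul_left, ← tsum_mul_left, ← tsum_mul_left,
      ← (hsum P₀).tsum_add ((hsum P₁).mul_left _),
      ← ((hsum P₀).add ((hsum P₁).mul_left _)).tsum_add ((hsum P₂).mul_left _),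
      ← (((hsum P₀).add ((hsum P₁).mul_left _)).add ((hsum P₂).mul_left _)).tsum_add
        (hs.mul_left _)]
    refine tsum_congr fun q => ?_
    rw [hg n _ hn]
    simp only [polyGauss, ← point_succ]
    ring
  have g₀ := h₀ _ hm
  have g₁ := h₁ _ hm
  have g₂ := h₂ _ hm
  rw [e]
  generalize (∑' q : ℕ, mesh n * polyGauss P₀ (((q : ℝ) + 1) * mesh n)) = s₀ at g₀ ⊢
  generalize (∑' q : ℕ, mesh n * polyGauss P₁ (((q : ℝ) + 1) * mesh n)) = s₁ at g₁ ⊢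
  generalize (∑' q : ℕ, mesh n * polyGauss P₂ (((q : ℝ) + 1) * mesh n)) = s₂ at g₂ ⊢
  generalize (∑' q : ℕ, mesh n * (Real.exp (-point n (q + 1) ^ 2 / 2) * R n (q + 1))) = s at hb ⊢
  generalize mesh n = h at *
  rw [show s₀ + h * s₁ + h ^ 2 * s₂ + h ^ 3 * s -
      (gaussIntegral P₀ + h * (gaussIntegral P₁ - P₀.coeff 0 / 2) +
        h ^ 2 * (gaussIntegral P₂ - P₁.coeff 0 / 2 - P₀.coeff 1 / 12)) =
      h ^ 3 * s + (s₀ - (gaussIntegral P₀ - h * P₀.coeff 0 / 2 - h ^ 2 * P₀.coeff 1 / 12)) +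
      h * (s₁ - (gaussIntegral P₁ - h * P₁.coeff 0 / 2 - h ^ 2 * P₁.coeff 1 / 12)) +
      h ^ 2 * (s₂ - (gaussIntegral P₂ - h * P₂.coeff 0 / 2 - h ^ 2 * P₂.coeff 1 / 12)) +
      -(h ^ 3 * P₁.coeff 1 / 12) + -(h ^ 3 * P₂.coeff 0 / 2) +
      -(h ^ 4 * P₂.coeff 1 / 12) by ring]
  have h3 : 0 < h ^ 3 := by positivity
  have b₁ : |h * (s₁ - (gaussIntegral P₁ - h * P₁.coeff 0 / 2 - h ^ 2 * P₁.coeff 1 / 12))| ≤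
      |C₁| * h ^ 3 := by
    rw [abs_mul, abs_of_pos hm]
    calc _ ≤ 1 * (|C₁| * h ^ 3) := mul_le_mul hm1
          (g₁.trans (mul_le_mul_of_nonneg_right (le_abs_self _) h3.le)) (abs_nonneg _) zero_le_one
      _ = _ := one_mul _
  have b₂ : |h ^ 2 * (s₂ - (gaussIntegral P₂ - h * P₂.coeff 0 / 2 - h ^ 2 * P₂.coeff 1 / 12))| ≤
      |C₂| * h ^ 3 := by
    rw [abs_mul, abs_of_pos (pow_pos hm 2)]
    calc _ ≤ 1 * (|C₂| * h ^ 3) := mul_le_mul (pow_le_one₀ hm.le hm1)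
          (g₂.trans (mul_le_mul_of_nonneg_right (le_abs_self _) h3.le)) (abs_nonneg _) zero_le_one
      _ = _ := one_mul _
  have b : |h ^ 3 * s| ≤ B * h ^ 3 := by
    rw [abs_mul, abs_of_pos h3, mul_comm]
    gcongr
  have c₁ : |-(h ^ 3 * P₁.coeff 1 / 12)| ≤ |P₁.coeff 1| * h ^ 3 := by
    rw [abs_neg, abs_div, abs_mul, abs_of_pos h3, abs_of_pos (by norm_num : (0 : ℝ) < 12)]
    nlinarith [mul_nonneg (abs_nonneg (P₁.coeff 1)) h3.le]
  have c₂ : |-(h ^ 3 * P₂.coeff 0 / 2)| ≤ |P₂.coeff 0| * h ^ 3 := by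
    rw [abs_neg, abs_div, abs_mul, abs_of_pos h3, abs_two]
    nlinarith [mul_nonneg (abs_nonneg (P₂.coeff 0)) h3.le]
  have c₃ : |-(h ^ 4 * P₂.coeff 1 / 12)| ≤ |P₂.coeff 1| * h ^ 3 := by
    rw [abs_neg, abs_div, abs_mul, abs_of_pos (pow_pos hm 4),
      abs_of_pos (by norm_num : (0 : ℝ) < 12)]
    have : h ^ 4 ≤ h ^ 3 := pow_le_pow_of_le_one hm.le hm1 (by norm_num)
    nlinarith [mul_nonneg (abs_nonneg (P₂.coeff 1)) h3.le,
      mul_le_mul_of_nonneg_right this (abs_nonneg (P₂.coeff 1)),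
      mul_nonneg (abs_nonneg (P₂.coeff 1)) (pow_pos hm 4).le]
  simp only [add_mul]
  exact (abs_add_le _ _).trans <| (add_le_add_left ((abs_add_le _ _).trans <|
    add_le_add_left ((abs_add_le _ _).trans <| add_le_add ((abs_add_le _ _).trans <|
      add_le_add ((abs_add_le _ _).trans <| add_le_add ((abs_add_le _ _).trans <|
        add_le_add b g₀) b₁) b₂) c₁) _) _).trans (by linarith)

end Sums

/-! ### Coefficients of the moment expansion and the exact order -/

section Moments

open Polynomial

/-- The coefficient of `1` in the integrand of the `j + 1`-st moment. -/
noncomputable def momentPoly₀ (j : ℕ) : ℝ[X] := monomial j ((j : ℝ) + 1)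

/-- The coefficient of `1 / √n` in the integrand of the `j + 1`-st moment. -/
noncomputable def momentPoly₁ (j : ℕ) : ℝ[X] :=
  monomial (j - 1) (-((j + 1).choose 2 : ℝ)) + monomial (j + 1) (-((j : ℝ) + 1) / 2) +
    monomial (j + 3) (-((j : ℝ) + 1) / 3)

/-- The coefficient of `1 / n` in the integrand of the `j + 1`-st moment. -/
noncomputable def momentPoly₂ (j : ℕ) : ℝ[X] :=
  monomial (j - 2) ((j + 1).choose 3 : ℝ) + monomial j (((j + 1).choose 2 : ℝ) / 2) +
    monomial (j + 2) (((j + 1).choose 2 : ℝ) / 3) + monomial (j + 2) (-((j : ℝ) + 1) / 8) +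
    monomial (j + 4) (-((j : ℝ) + 1) / 12) + monomial (j + 6) (((j : ℝ) + 1) / 18)

theorem moment_expansion_gaussIntegral {α : Type*} [LinearOrder α] {s : ∀ n : ℕ, Fin n → α}
    (hs : ∀ n : ℕ, Function.Injective (s n)) (j : ℕ) :
    ∃ C : ℝ, ∀ n, 1 ≤ n →
      |moment (normalizedPasses (s n)) (j + 1) (uniformPerm n) -
        (gaussIntegral (momentPoly₀ j) +
          mesh n * (gaussIntegral (momentPoly₁ j) - (momentPoly₀ j).coeff 0 / 2) +
          mesh n ^ 2 * (gaussIntegral (momentPoly₂ j) - (momentPoly₁ j).coeff 0 / 2 -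
            (momentPoly₀ j).coeff 1 / 12))| ≤ C * mesh n ^ 3 := by
  set d₁ : ℝ → ℝ := fun x => (j + 1).choose 1 * x ^ (j + 1 - 1) with hd₁
  set d₂ : ℝ → ℝ := fun x => (j + 1).choose 2 * x ^ (j + 1 - 2) with hd₂
  set d₃ : ℝ → ℝ := fun x => (j + 1).choose 3 * x ^ (j + 1 - 3) with hd₃
  have hd : ∀ (c : ℝ) (m : ℕ), PolyBounded (fun _ _ => True) fun n q => c * point n q ^ m :=
    fun c m => (PolyBounded.const c).mul (PolyBounded.point.pow m)
  set b : ℝ → ℝ := fun x => firstCorrection x ^ 2 / 2 - secondCorrection x with hb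
  have hbb : PolyBounded (fun _ _ => True) fun n q => b (point n q) :=
    ((polyBounded_firstCorrection.pow 2).div_const 2).sub polyBounded_secondCorrection
  set g : ℕ → ℕ → ℝ := fun n q => (d₁ (point n q) - mesh n * d₂ (point n q) +
    mesh n ^ 2 * d₃ (point n q) - mesh n ^ 3 * powSubRem (mesh n) (point n q) (j + 1)) *
      (survivalMain n q + mesh n ^ 3 * survivalRem n q) with hg
  set R : ℕ → ℕ → ℝ := fun n q => d₁ (point n q) * survivalRem n q -
    d₂ (point n q) * (b (point n q) + mesh n * survivalRem n q) +
    d₃ (point n q) * (mesh n * b (point n q) + mesh n ^ 2 * survivalRem n q -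
      firstCorrection (point n q)) -
    powSubRem (mesh n) (point n q) (j + 1) * (survivalMain n q + mesh n ^ 3 * survivalRem n q)
    with hR
  have hRb : PolyBounded (fun _ _ => True) R :=
    ((((hd _ _).mul polyBounded_survivalRem).sub ((hd _ _).mul (hbb.add
      (PolyBounded.mesh.mul polyBounded_survivalRem)))).add ((hd _ _).mul
        (((PolyBounded.mesh.mul hbb).add ((PolyBounded.mesh.pow 2).mul
          polyBounded_survivalRem)).sub polyBounded_firstCorrection))).sub
      ((polyBounded_powSubRem _).mul (polyBounded_survivalMain.add ((PolyBounded.mesh.pow 3).mul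
        polyBounded_survivalRem)))
  -- For `j = 0` the exponent is truncated, but the binomial coefficient vanishes.
  have ex₂ : ∀ x, x * d₂ x = (j + 1).choose 2 * x ^ j := by
    intro x
    simp only [hd₂]
    rcases j with _ | j
    · simp
    · rw [show j + 1 + 1 - 2 = j by omega, pow_succ]
      ring
  have key : ∀ n q, 1 ≤ n → g n q = (momentPoly₀ j).eval (point n q) +
      mesh n * (momentPoly₁ j).eval (point n q) + mesh n ^ 2 * (momentPoly₂ j).eval (point n q) +
      mesh n ^ 3 * R n q := by
    intro n q _
    have e₀ : (momentPoly₀ j).eval (point n q) = d₁ (point n q) := by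
      simp only [momentPoly₀, eval_monomial, hd₁, Nat.choose_one_right, Nat.add_sub_cancel]
      push_cast
      ring
    have e₁ : (momentPoly₁ j).eval (point n q) =
        -d₂ (point n q) - firstCorrection (point n q) * d₁ (point n q) := by
      simp only [momentPoly₁, eval_add, eval_monomial, hd₁, hd₂, firstCorrection,
        Nat.choose_one_right, Nat.add_sub_cancel]
      rw [show j + 1 - 2 = j - 1 by omega]
      push_cast
      ring
    have e₂ : (momentPoly₂ j).eval (point n q) = d₃ (point n q) +
        firstCorrection (point n q) * d₂ (point n q) + b (point n q) * d₁ (point n q) := by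
      have h1 : firstCorrection (point n q) * d₂ (point n q) =
          (j + 1).choose 2 * point n q ^ j * (1 / 2 + point n q ^ 2 / 3) := by
        rw [← ex₂, firstCorrection]
        ring
      rw [h1]
      simp only [momentPoly₂, eval_add, eval_monomial, hd₁, hd₃, hb, firstCorrection,
        secondCorrection, Nat.choose_one_right, Nat.add_sub_cancel]
      rw [show j + 1 - 3 = j - 2 by omega]
      push_cast
      ring
    rw [e₀, e₁, e₂]
    simp only [hg, hR, survivalMain]
    rw [← show b (point n q) =
      firstCorrection (point n q) ^ 2 / 2 - secondCorrection (point n q) from rfl]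
    ring
  obtain ⟨C, hC⟩ := tsum_expansion hRb key
  refine ⟨C, fun n hn => ?_⟩
  refine le_trans (le_of_eq ?_) (hC n hn)
  congr 2
  rw [moment_normalizedPasses (hs n) hn j.succ_ne_zero]
  have hterm : ∀ q : ℕ, (((q : ℝ) + 1) ^ (j + 1) - (q : ℝ) ^ (j + 1)) * survival n (q + 1) /
      √(n : ℝ) ^ (j + 1) =
      mesh n * (Real.exp (-point n (q + 1) ^ 2 / 2) * g n (q + 1)) := by
    intro q
    have h1 : mesh n * (d₁ (point n (q + 1)) - mesh n * d₂ (point n (q + 1)) +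
        mesh n ^ 2 * d₃ (point n (q + 1)) -
        mesh n ^ 3 * powSubRem (mesh n) (point n (q + 1)) (j + 1)) =
        point n (q + 1) ^ (j + 1) - (point n (q + 1) - mesh n) ^ (j + 1) := by
      rw [sub_pow_expansion]
      ring
    have h2 : point n (q + 1) - mesh n = q * mesh n := by
      rw [point_succ]
      ring
    have h3 : mesh n ^ (j + 1) = 1 / √(n : ℝ) ^ (j + 1) := by
      rw [mesh, div_pow, one_pow]
    rw [h2, mul_pow, h3] at h1
    have h4 : point n (q + 1) ^ (j + 1) = ((q : ℝ) + 1) ^ (j + 1) * (1 / √(n : ℝ) ^ (j + 1)) := by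
      rw [point_succ, mul_pow, h3]
    rw [h4] at h1
    simp only [hg]
    rw [survival_eq hn]
    linear_combination (-(Real.exp (-point n (q + 1) ^ 2 / 2) *
      (survivalMain n (q + 1) + mesh n ^ 3 * survivalRem n (q + 1)))) * h1
  -- The finite sum is the full series, as `survival n (q + 1)` vanishes for `q ≥ n`.
  rw [Finset.sum_congr rfl fun q _ => hterm q, tsum_eq_sum]
  intro q hq
  rw [← hterm, survival_of_le hn (by rw [Finset.mem_range] at hq; omega)]
  simp

/-- The moment `∫ x ^ j exp (-x² / 2)` over the positive half-line. -/
noncomputable def gaussMoment (j : ℕ) : ℝ := √2 ^ (j + 1) / 2 * Real.Gamma (((j : ℝ) + 1) / 2)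

theorem gaussMoment_pos (j : ℕ) : 0 < gaussMoment j := by
  have : 0 < Real.Gamma (((j : ℝ) + 1) / 2) := Real.Gamma_pos_of_pos (by positivity)
  unfold gaussMoment
  positivity

theorem gaussMoment_add_two (j : ℕ) : gaussMoment (j + 2) = (j + 1) * gaussMoment j := by
  have h : (((j + 2 : ℕ) : ℝ) + 1) / 2 = ((j : ℝ) + 1) / 2 + 1 := by push_cast; ring
  rw [gaussMoment, gaussMoment, h, Real.Gamma_add_one (by positivity), pow_add √2 (j + 1) 2,
    Real.sq_sqrt zero_le_two]
  ring

theorem gaussMoment_one : gaussMoment 1 = 1 := by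
  simp [gaussMoment]

theorem gaussIntegral_momentPoly₀ (j : ℕ) :
    gaussIntegral (momentPoly₀ j) =
      √2 ^ (j + 1) * Real.Gamma (((j + 1 : ℕ) : ℝ) / 2 + 1) := by
  rw [momentPoly₀, gaussIntegral_monomial, Real.Gamma_add_one (by positivity)]
  push_cast
  ring

theorem gaussIntegral_momentPoly₁ (j : ℕ) :
    gaussIntegral (momentPoly₁ j) - (momentPoly₀ j).coeff 0 / 2 =
      -(√2 ^ (j + 1) * (√2 * ((j + 1 : ℕ) : ℝ) * (((j + 1 : ℕ) : ℝ) + 4) / 6 *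
        Real.Gamma ((((j + 1 : ℕ) : ℝ) + 1) / 2))) := by
  have h : -(√2 ^ (j + 1) * (√2 * ((j + 1 : ℕ) : ℝ) * (((j + 1 : ℕ) : ℝ) + 4) / 6 *
      Real.Gamma ((((j + 1 : ℕ) : ℝ) + 1) / 2))) =
      -((j + 1 : ℝ) * (j + 5) / 3 * gaussMoment (j + 1)) := by
    rw [gaussMoment]
    push_cast
    ring
  rw [h]
  simp only [momentPoly₁, momentPoly₀, gaussIntegral_add, gaussIntegral_monomial,
    coeff_monomial]
  simp only [← gaussMoment.eq_1]
  rw [gaussMoment_add_two (j + 1)]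
  -- Only for `j = 0` is there a boundary term, `-1 / 2`.
  rcases j with _ | j
  · norm_num [gaussMoment_one, Nat.choose]
  · rw [Nat.add_sub_cancel, gaussMoment_add_two j, Nat.cast_choose_two]
    push_cast
    simp
    ring

theorem gaussIntegral_momentPoly₂ (j : ℕ) :
    gaussIntegral (momentPoly₂ j) - (momentPoly₁ j).coeff 0 / 2 - (momentPoly₀ j).coeff 1 / 12 =
      (4 * (j : ℝ) ^ 3 + 42 * (j : ℝ) ^ 2 + 101 * j + 33) / 72 * (j + 1) * gaussMoment j := by
  simp only [momentPoly₂, momentPoly₁, momentPoly₀, gaussIntegral_add, gaussIntegral_monomial,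
    coeff_monomial, coeff_add]
  simp only [← gaussMoment.eq_1]
  rw [gaussMoment_add_two (j + 4), gaussMoment_add_two (j + 2), gaussMoment_add_two j]
  -- Boundary terms occur only for `j = 1`; they sum to `1 / 2 - 1 / 6`.
  rcases j with _ | _ | j
  · norm_num [Nat.choose]
    ring
  · norm_num [Nat.choose, gaussMoment_one]
  · have h3 : (((j + 1 + 1 + 1).choose 3 : ℕ) : ℝ) = (j + 1) * (j + 2) * (j + 3) / 6 := by
      have h := congrArg (Nat.cast (R := ℝ)) (Nat.add_one_mul_choose_eq (j + 2) 2)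
      push_cast [Nat.cast_choose_two] at h
      linarith
    rw [Nat.add_sub_cancel, gaussMoment_add_two j, Nat.cast_choose_two, h3]
    push_cast
    simp
    ring

theorem moment_expansion {α : Type*} [LinearOrder α] {s : ∀ n : ℕ, Fin n → α}
    (hs : ∀ n : ℕ, Function.Injective (s n)) {k : ℕ} (hk : 1 ≤ k) :
    ∃ c C : ℝ, 0 < c ∧ ∀ n, 1 ≤ n →
      |moment (normalizedPasses (s n)) k (uniformPerm n) / √2 ^ k -
        (Real.Gamma ((k : ℝ) / 2 + 1) - √2 * (k : ℝ) * ((k : ℝ) + 4) / (6 * √(n : ℝ)) *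
          Real.Gamma (((k : ℝ) + 1) / 2)) - c * (1 / (n : ℝ))| ≤ C * mesh n ^ 3 := by
  obtain ⟨j, rfl⟩ := Nat.exists_eq_add_of_le' hk
  obtain ⟨C, hC⟩ := moment_expansion_gaussIntegral hs j
  have hpos : (0 : ℝ) < √2 ^ (j + 1) := by positivity
  have hM := gaussMoment_pos j
  refine ⟨(4 * (j : ℝ) ^ 3 + 42 * (j : ℝ) ^ 2 + 101 * j + 33) / 72 * (j + 1) * gaussMoment j /
    √2 ^ (j + 1), C / √2 ^ (j + 1), by positivity, fun n hn => ?_⟩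
  have h := hC n hn
  rw [gaussIntegral_momentPoly₀, gaussIntegral_momentPoly₁, gaussIntegral_momentPoly₂] at h
  rw [show C / √2 ^ (j + 1) * mesh n ^ 3 = C * mesh n ^ 3 / √2 ^ (j + 1) by ring,
    le_div_iff₀ hpos]
  refine le_trans (le_of_eq ?_) h
  rw [← abs_of_pos hpos, ← abs_mul, abs_of_pos hpos, ← mesh_sq]
  congr 1
  have hsq : √2 * ((j + 1 : ℕ) : ℝ) * (((j + 1 : ℕ) : ℝ) + 4) / (6 * √(n : ℝ)) =
      mesh n * (√2 * ((j + 1 : ℕ) : ℝ) * (((j + 1 : ℕ) : ℝ) + 4) / 6) := by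
    rw [mesh]
    ring
  rw [hsq]
  field_simp
  ring

theorem isTheta_of_abs_sub_le {r : ℕ → ℝ} {c C : ℝ} (hc : c ≠ 0)
    (h : ∀ n, 1 ≤ n → |r n - c * (1 / (n : ℝ))| ≤ C * mesh n ^ 3) :
    r =Θ[atTop] fun n : ℕ => 1 / (n : ℝ) := by
  have h0 : Tendsto mesh atTop (nhds 0) :=
    tendsto_const_nhds.div_atTop
      (Real.tendsto_sqrt_atTop.comp tendsto_natCast_atTop_atTop)
  have h1 : (fun n => r n - c * (1 / (n : ℝ))) =O[atTop] fun n : ℕ => mesh n * (1 / (n : ℝ)) := by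
    refine IsBigO.of_bound C ?_
    filter_upwards [eventually_ge_atTop 1] with n hn
    have hm := mesh_pos hn
    rw [Real.norm_eq_abs, ← mesh_sq, ← pow_succ', Real.norm_eq_abs, abs_of_pos (pow_pos hm 3),
      mesh_sq]
    exact h n hn
  have h2 : (fun n : ℕ => mesh n * (1 / (n : ℝ))) =o[atTop] fun n : ℕ => c * (1 / (n : ℝ)) := by
    have := ((isLittleO_one_iff ℝ).mpr h0).mul_isBigO
      (isBigO_refl (fun n : ℕ => 1 / (n : ℝ)) atTop)
    simp only [one_mul] at this
    exact this.trans_isBigO ((isBigO_refl _ _).const_mul_right hc)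
  have h3 : IsEquivalent atTop r fun n : ℕ => c * (1 / (n : ℝ)) := h1.trans_isLittleO h2
  exact h3.isTheta.trans ((isTheta_refl _ _).const_mul_left hc)

end Moments

end BubbleSort

theorem mainTheorem6 {α : Type*} [LinearOrder α] (s : ∀ n : ℕ, Fin n → α)
    (hs : ∀ n : ℕ, Function.Injective (s n)) (k : ℕ) :
    ∃ r : ℕ → ℝ,
      (∀ n : ℕ, 1 ≤ n →
        moment (BubbleSort.normalizedPasses (s n)) k (BubbleSort.uniformPerm n) =
          √2 ^ k * (Real.Gamma ((k : ℝ) / 2 + 1)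
            - √2 * (k : ℝ) * ((k : ℝ) + 4) / (6 * √(n : ℝ)) * Real.Gamma (((k : ℝ) + 1) / 2)
            + r n)) ∧
      r =O[atTop] (fun n : ℕ => 1 / (n : ℝ)) ∧
      (1 ≤ k → r =Θ[atTop] (fun n : ℕ => 1 / (n : ℝ))) := by
  rcases Nat.eq_zero_or_pos k with rfl | hk
  · refine ⟨fun _ => 0, fun n _ => ?_, isBigO_zero _ _, fun h => absurd h (by norm_num)⟩
    have : IsProbabilityMeasure (BubbleSort.uniformPerm n) :=
      PMF.toMeasure.isProbabilityMeasure _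
    simp [moment]
  · obtain ⟨c, C, hc, h⟩ := BubbleSort.moment_expansion hs hk
    have hΘ := BubbleSort.isTheta_of_abs_sub_le hc.ne' h
    -- The witness, read off from `hΘ`, is the rescaled moment minus its explicit terms.
    refine ⟨_, fun n _ => ?_, hΘ.1, fun _ => hΘ⟩
    have hpos : (0 : ℝ) < √2 ^ k := by positivity
    rw [add_sub_cancel, mul_div_cancel₀ _ hpos.ne']
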